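/- Let $a<b$, $\varepsilon_0>0$, and write $L_2=L_2([a,b],\mathbb C)$. For each $\varepsilon\in[0,\varepsilon_0]$ let $q_\varepsilon\in L_2$ and $\alpha(\varepsilon),\beta(\varepsilon)\in\mathbb C^{2\times2}$. For a function $y$ on $[a,b]$ define the quasi-derivatives $$D^{[1]}_\varepsilon y=y'-q_\varepsilon y,\qquad D^{[2]}_\varepsilon y=-(D^{[1]}_\varepsilon y)'-q_\varepsilon D^{[1]}_\varepsilon y-q_\varepsilon^2y ,$$ where $y$ and $D^{[1]}_\varepsilon y$ are required to be absolutely continuous on $[a,b]$. Let $L_\varepsilon$ be the operator in $L_2$ generated by the formal expression $-y''+q_\varepsilon'y$, that is, $$L_\varepsilon y=D^{[2]}_\varepsilon y,\qquad \mathrm{Dom}(L_\varepsilon)=\{y\in L_2:\ D^{[2]}_\varepsilon y \text{ exists and lies in } L_2,\ \ \alpha(\varepsilon)\mathcal Y_a(\varepsilon)+\beta(\varepsilon)\mathcal Y_b(\varepsilon)=0\},$$ with $\mathcal Y_a(\varepsilon)=(y(a),D^{[1]}_\varepsilon y(a))$ and $\mathcal Y_b(\varepsilon)=(y(b),D^{[1]}_\varepsilon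 y(b))$ in $\mathbb C^2$. For integrable $c$ put $c^\vee(t)=\int_a^tc(x)\,dx$, and let $\|\cdot\|_C$ be the sup-norm on $[a,b]$. Suppose that the resolvent set $\rho(L_0)$ is not empty and that, as $\varepsilon\to+0$: 1) $\|q_\varepsilon\|_2=O(1)$; 2) $\|(q_\varepsilon-q_0)^\vee\|_C\to0$; 3) $\|(q_\varepsilon^2-q_0^2)^\vee\|_C\to0$; 4) $\alpha(\varepsilon)\to\alpha(0)$ and $\beta(\varepsilon)\to\beta(0)$. Then $L_\varepsilon\to L_0$ in the sense of norm resolvent convergence: there is $\mu\in\rho(L_0)$ such that $\mu\in\rho(L_\varepsilon)$ for all sufficiently small $\varepsilon>0$ and $\|(L_\varepsilon-\mu)^{-1}-(L_0-\mu)^{-1}\|\to0$ as $\varepsilon\to+0$. Moreover, for every $\mu\in\rho(L_0)$ the following holds. For $\varepsilon=0$ and for all sufficiently small $\varepsilon>0$, $\mu\in\rho(L_\varepsilon)$ and $L_\varepsilon-\mu$ has a Green function $\Gamma(\cdot,\cdot;\varepsilon)\in L_\infty([a,b]\times[a,b])$, that is, $$\big((L_\varepsilon-\mu)^{-1}f\big)(t)=\int_a^b\Gamma(t,s;\varepsilon)f(s)\,ds\quad\text{for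 almost every } t\in[a,b],\ \text{for every } f\in L_2,$$ and $\|\Gamma(\cdot,\cdot;\varepsilon)-\Gamma(\cdot,\cdot;0)\|_\infty\to0$ as $\varepsilon\to+0$, the norm being that of $L_\infty([a,b]\times[a,b])$. -/

import Mathlib

open MeasureTheory Filter Topology Set
open scoped ENNReal Matrix

namespace SturmLiouville

/-- Lebesgue measure on the compact interval `[a, b]`. -/
noncomputable abbrev leb (a b : ℝ) : Measure ℝ := volume.restrict (Icc a b)

/-- The complex Hilbert space `L_2 = L_2([a, b], ℂ)`. -/
noncomputable abbrev L2 (a b : ℝ) : Type := Lp ℂ 2 (leb a b)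

/-- The function `y` has the quasi-derivatives `D^[1] y = y' - q y = u` and
`D^[2] y = -(D^[1] y)' - q D^[1] y - q ^ 2 y = g` on `[a, b]`: both `y` and `u` (the continuous
representative of `y' - q y`) are absolutely continuous, and the equations hold almost everywhere.
Absolutely continuous functions are differentiable almost everywhere, so that `deriv` takes no
default value outside a null set. -/
structure HasQuasiDerivs (a b : ℝ) (q y u g : ℝ → ℂ) : Prop where
  ac_zero : AbsolutelyContinuousOnInterval y a b
  ac_one : AbsolutelyContinuousOnInterval u a b
  deriv_one : ∀ᵐ t ∂(leb a b), u t = deriv y t - q t * y t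
  deriv_two : ∀ᵐ t ∂(leb a b), g t = -deriv u t - q t * u t - q t ^ 2 * y t

/-- The boundary condition `α 𝒴_a + β 𝒴_b = 0`, where `𝒴_a = (y(a), D^[1] y(a))`,
`𝒴_b = (y(b), D^[1] y(b))` and `u = D^[1] y`. -/
def BoundaryCondition (a b : ℝ) (α β : Matrix (Fin 2) (Fin 2) ℂ) (y u : ℝ → ℂ) : Prop :=
  α *ᵥ ![y a, u a] + β *ᵥ ![y b, u b] = 0

theorem ae_differentiableAt_of_ac {a b : ℝ} {y : ℝ → ℂ}
    (hy : AbsolutelyContinuousOnInterval y a b) :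
    ∀ᵐ t ∂(leb a b), DifferentiableAt ℝ y t := by
  rw [ae_restrict_iff' measurableSet_Icc]
  have h := hy.boundedVariationOn.locallyBoundedVariationOn.ae_differentiableWithinAt_of_mem
  have ha : ∀ᵐ t : ℝ, t ≠ a := by simp [ae_iff]
  have hb : ∀ᵐ t : ℝ, t ≠ b := by simp [ae_iff]
  filter_upwards [h, ha, hb] with t ht hta htb htm
  have h1 : a < t := lt_of_le_of_ne htm.1 (Ne.symm hta)
  have h2 : t < b := lt_of_le_of_ne htm.2 htb
  refine (ht (Icc_subset_uIcc htm)).differentiableAt ?_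
  exact mem_of_superset (Icc_mem_nhds h1 h2) Icc_subset_uIcc

theorem HasQuasiDerivs.add {a b : ℝ} {q y u g y' u' g' : ℝ → ℂ}
    (h : HasQuasiDerivs a b q y u g) (h' : HasQuasiDerivs a b q y' u' g') :
    HasQuasiDerivs a b q (y + y') (u + u') (g + g') := by
  refine ⟨h.ac_zero.add h'.ac_zero, h.ac_one.add h'.ac_one, ?_, ?_⟩
  · filter_upwards [h.deriv_one, h'.deriv_one, ae_differentiableAt_of_ac h.ac_zero,
      ae_differentiableAt_of_ac h'.ac_zero] with t h1 h2 h3 h4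
    rw [deriv_add h3 h4]
    simp only [Pi.add_apply, h1, h2]
    ring
  · filter_upwards [h.deriv_two, h'.deriv_two, ae_differentiableAt_of_ac h.ac_one,
      ae_differentiableAt_of_ac h'.ac_one] with t h1 h2 h3 h4
    rw [deriv_add h3 h4]
    simp only [Pi.add_apply, h1, h2]
    ring

theorem HasQuasiDerivs.smul {a b : ℝ} {q y u g : ℝ → ℂ} (c : ℂ)
    (h : HasQuasiDerivs a b q y u g) :
    HasQuasiDerivs a b q (c • y) (c • u) (c • g) := by
  refine ⟨h.ac_zero.const_smul c, h.ac_one.const_smul c, ?_, ?_⟩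
  · filter_upwards [h.deriv_one, ae_differentiableAt_of_ac h.ac_zero] with t h1 h3
    rw [deriv_const_smul c h3]
    simp only [Pi.smul_apply, smul_eq_mul, h1]
    ring
  · filter_upwards [h.deriv_two, ae_differentiableAt_of_ac h.ac_one] with t h1 h3
    rw [deriv_const_smul c h3]
    simp only [Pi.smul_apply, smul_eq_mul, h1]
    ring

/-- A continuous function on `[a, b]`, `a < b`, which is zero almost everywhere has the zero
derivative almost everywhere. -/
theorem ae_deriv_eq_zero {a b : ℝ} {y : ℝ → ℂ} (hab : a < b)
    (hy : AbsolutelyContinuousOnInterval y a b) (h0 : y =ᵐ[leb a b] 0) :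
    ∀ᵐ t ∂(leb a b), deriv y t = 0 := by
  have hc : ContinuousOn y (Icc a b) := by simpa [uIcc_of_le hab.le] using hy.continuousOn
  have hz : EqOn y 0 (Icc a b) :=
    Measure.eqOn_Icc_of_ae_eq volume hab.ne h0 hc continuousOn_const
  rw [ae_restrict_iff' measurableSet_Icc]
  have ha : ∀ᵐ t : ℝ, t ≠ a := by simp [ae_iff]
  have hb : ∀ᵐ t : ℝ, t ≠ b := by simp [ae_iff]
  filter_upwards [ha, hb] with t hta htb htm
  have h1 : a < t := lt_of_le_of_ne htm.1 (Ne.symm hta)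
  have h2 : t < b := lt_of_le_of_ne htm.2 htb
  have : y =ᶠ[𝓝 t] 0 := mem_of_superset (Icc_mem_nhds h1 h2) hz
  rw [this.deriv_eq]
  simp

/-- Quasi-derivatives are unique as elements of `L_2`. -/
theorem HasQuasiDerivs.eq_zero {a b : ℝ} {q y u g : ℝ → ℂ} (hab : a < b)
    (h : HasQuasiDerivs a b q y u g) (h0 : y =ᵐ[leb a b] 0) : g =ᵐ[leb a b] 0 := by
  have hu : u =ᵐ[leb a b] 0 := by
    filter_upwards [h.deriv_one, ae_deriv_eq_zero hab h.ac_zero h0, h0] with t h1 h2 h3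
    simp [h1, h2, h3]
  filter_upwards [h.deriv_two, ae_deriv_eq_zero hab h.ac_one hu, h0, hu] with t h1 h2 h3 h4
  simp [h1, h2, h3, h4]

/-- The graph of the operator generated by `-y'' + q' y` and the boundary condition: all pairs
`(y, D^[2] y)` in `L_2 × L_2` such that (the continuous representative of) `y` has the
quasi-derivatives `D^[1] y` and `D^[2] y` and satisfies the boundary condition. -/
noncomputable def graph (a b : ℝ) (q : ℝ → ℂ) (α β : Matrix (Fin 2) (Fin 2) ℂ) :
    Submodule ℂ (L2 a b × L2 a b) where
  carrier := {p | ∃ y u g : ℝ → ℂ, HasQuasiDerivs a b q y u g ∧ BoundaryCondition a b α β y u ∧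
    p.1 =ᵐ[leb a b] y ∧ p.2 =ᵐ[leb a b] g}
  zero_mem' := by
    refine ⟨0, 0, 0, ⟨?_, ?_, ?_, ?_⟩, ?_, Lp.coeFn_zero _ _ _, Lp.coeFn_zero _ _ _⟩
    · exact (LipschitzWith.const (0 : ℂ)).lipschitzOnWith.absolutelyContinuousOnInterval
    · exact (LipschitzWith.const (0 : ℂ)).lipschitzOnWith.absolutelyContinuousOnInterval
    · exact Eventually.of_forall fun t => by simp
    · exact Eventually.of_forall fun t => by simp
    · ext i
      fin_cases i <;> simp
  add_mem' := by
    rintro ⟨p, r⟩ ⟨p', r'⟩ ⟨y, u, g, h, hb, h1, h2⟩ ⟨y', u', g', h', hb', h1', h2'⟩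
    refine ⟨y + y', u + u', g + g', h.add h', ?_, (Lp.coeFn_add _ _).trans (h1.add h1'),
      (Lp.coeFn_add _ _).trans (h2.add h2')⟩
    unfold BoundaryCondition at *
    have e : ∀ t, ![(y + y') t, (u + u') t] = ![y t, u t] + ![y' t, u' t] := by
      intro t
      ext i
      fin_cases i <;> simp
    rw [e, e, Matrix.mulVec_add, Matrix.mulVec_add, add_add_add_comm, hb, hb', add_zero]
  smul_mem' := by
    rintro c ⟨p, r⟩ ⟨y, u, g, h, hb, h1, h2⟩
    refine ⟨c • y, c • u, c • g, h.smul c, ?_, (Lp.coeFn_smul _ _).trans (h1.const_smul c),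
      (Lp.coeFn_smul _ _).trans (h2.const_smul c)⟩
    unfold BoundaryCondition at *
    have e : ∀ t, ![(c • y) t, (c • u) t] = c • ![y t, u t] := by
      intro t
      ext i
      fin_cases i <;> simp
    rw [e, e, Matrix.mulVec_smul, Matrix.mulVec_smul, ← smul_add, hb, smul_zero]

/-- The unbounded Sturm-Liouville operator in `L_2` generated by `-y'' + q' y` and the boundary
condition `α 𝒴_a + β 𝒴_b = 0`, as a partially defined linear operator. -/
noncomputable def operator (a b : ℝ) (q : ℝ → ℂ) (α β : Matrix (Fin 2) (Fin 2) ℂ) :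
    L2 a b →ₗ.[ℂ] L2 a b :=
  (graph a b q α β).toLinearPMap

/-- The operator has the prescribed graph. -/
theorem graph_operator {a b : ℝ} (hab : a < b) (q : ℝ → ℂ) (α β : Matrix (Fin 2) (Fin 2) ℂ) :
    (operator a b q α β).graph = graph a b q α β := by
  refine Submodule.toLinearPMap_graph_eq _ ?_
  rintro ⟨p, r⟩ ⟨y, u, g, h, -, h1, h2⟩ h0
  simp only at h0 h1 h2 ⊢
  subst h0
  have hy : y =ᵐ[leb a b] 0 := h1.symm.trans (Lp.coeFn_zero _ _ _)
  exact (Lp.eq_zero_iff_ae_eq_zero).2 (h2.trans (h.eq_zero hab hy))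

section Resolvent

variable {H : Type*} [NormedAddCommGroup H] [NormedSpace ℂ H]

/-- `R` is a bounded everywhere defined two-sided inverse of `T - μ`. -/
def IsResolventAt (T : H →ₗ.[ℂ] H) (μ : ℂ) (R : H →L[ℂ] H) : Prop :=
  (∀ f : H, ∃ h : R f ∈ T.domain, T ⟨R f, h⟩ - μ • R f = f) ∧
    ∀ y : T.domain, R (T y - μ • (y : H)) = y

/-- The resolvent set `ρ(T)` of an unbounded operator `T`. -/
def resolventSet (T : H →ₗ.[ℂ] H) : Set ℂ := {μ | ∃ R : H →L[ℂ] H, IsResolventAt T μ R}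

open Classical in
/-- The resolvent `(T - μ)⁻¹`, for `μ ∈ ρ(T)` (and `0` for other `μ`). -/
noncomputable def resolvent (T : H →ₗ.[ℂ] H) (μ : ℂ) : H →L[ℂ] H :=
  if h : ∃ R : H →L[ℂ] H, IsResolventAt T μ R then h.choose else 0

theorem isResolventAt_resolvent {T : H →ₗ.[ℂ] H} {μ : ℂ} (h : μ ∈ resolventSet T) :
    IsResolventAt T μ (resolvent T μ) := by
  have h' : ∃ R : H →L[ℂ] H, IsResolventAt T μ R := h
  rw [resolvent, dif_pos h']
  exact h'.choose_spec

theorem IsResolventAt.eq_resolvent {T : H →ₗ.[ℂ] H} {μ : ℂ} {R : H →L[ℂ] H}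
    (h : IsResolventAt T μ R) : R = resolvent T μ := by
  ext f
  obtain ⟨hd, he⟩ := (isResolventAt_resolvent ⟨R, h⟩).1 f
  have := h.2 ⟨_, hd⟩
  rw [he] at this
  exact this

/-- Norm resolvent convergence of `T ε` to `T 0` as `ε → +0`: for some `μ ∈ ρ(T 0)`, one has
`μ ∈ ρ(T ε)` for all sufficiently small `ε > 0`, and
`‖(T ε - μ)⁻¹ - (T 0 - μ)⁻¹‖ → 0`. -/
def NormResolventConvergence (T : ℝ → H →ₗ.[ℂ] H) : Prop :=
  ∃ μ ∈ resolventSet (T 0), (∀ᶠ ε in 𝓝[>] (0 : ℝ), μ ∈ resolventSet (T ε)) ∧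
    Tendsto (fun ε => ‖resolvent (T ε) μ - resolvent (T 0) μ‖) (𝓝[>] (0 : ℝ)) (𝓝 0)

end Resolvent

/-- `Γ` is the Green function of `T - μ`: `μ ∈ ρ(T)`, `Γ ∈ L_∞([a, b] × [a, b])`, and
`((T - μ)⁻¹ f)(t) = ∫ Γ(t, s) f(s) ds` for every `f ∈ L_2`. -/
def IsGreenFunction (a b : ℝ) (T : L2 a b →ₗ.[ℂ] L2 a b) (μ : ℂ) (Γ : ℝ × ℝ → ℂ) : Prop :=
  μ ∈ resolventSet T ∧ MemLp Γ ∞ ((leb a b).prod (leb a b)) ∧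
    ∀ f : L2 a b, resolvent T μ f =ᵐ[leb a b] fun t => ∫ s in a..b, Γ (t, s) * f s

end SturmLiouville

/-! In terms of the pair (y, D^[1] y) the equation L_ε y - μ y = f is a linear first order system
whose matrix contains q_ε and q_ε² but no derivative of q_ε, so its coefficients are integrable. Let
φ, ψ be the solutions of the homogeneous system normalized at a, and Φ_ε their matrix at b. Their
Wronskian is 1, and variation of constants (`IsFundamentalSystem.representation`,
`IsFundamentalSystem.solvesSystem`) turns the boundary condition into a 2×2 linear equation with
matrix α + βΦ_ε for the initial values. If its determinant is nonzero, the resolvent is an integral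
operator with an explicit bounded kernel built from φ, ψ and N = -(α + βΦ_ε)⁻¹βΦ_ε
(`IsFundamentalSystem.isGreenFunction`). Conversely, a vector annihilated by the matrix yields an
eigenfunction, so the determinant is nonzero when μ is in the resolvent set
(`IsFundamentalSystem.det_ne_zero`).

Everything thus reduces to uniform convergence of the fundamental systems
(`tendsto_isSystemSolution`). The coefficients converge only through their primitives, but this
suffices: the difference Y_ε - Y_0 solves an equation with matrix A_ε and the source (A_ε - A_0)Y_0.
The limit solution Y_0 is absolutely continuous and independent of ε, so integration by parts
(`norm_integral_smul_le`) makes the primitive of the source uniformly small by conditions 2 and 3.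
Condition 1 bounds the Gronwall constant (`norm_linear_solution_sub_le`) uniformly in ε. The
determinant then stays nonzero for small ε, the kernels converge uniformly, and a sup bound on a
kernel bounds the operator norm in L_2. -/

namespace SturmLiouville

/-! ### Calculus of primitives of integrable functions -/

section Primitive

variable {E : Type*} [NormedAddCommGroup E]

theorem intervalIntegrable_of_integrable_leb {a b : ℝ} (hab : a ≤ b) {f : ℝ → E}
    (hf : Integrable f (leb a b)) : IntervalIntegrable f volume a b := by
  rw [intervalIntegrable_iff_integrableOn_Icc_of_le hab]
  exact hf

theorem intervalIntegrable_mono_Icc {a b : ℝ} {f : ℝ → E} (hf : IntervalIntegrable f volume a b)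
    {s t : ℝ} (hs : s ∈ Icc a b) (ht : t ∈ Icc a b) : IntervalIntegrable f volume s t := by
  refine hf.mono_set ?_
  rw [uIcc_of_le (hs.1.trans hs.2)]
  exact uIcc_subset_Icc hs ht

variable [NormedSpace ℝ E]

theorem ae_leb_mem_Ioo (a b : ℝ) : ∀ᵐ t ∂(leb a b), t ∈ Ioo a b := by
  rw [ae_restrict_iff' measurableSet_Icc]
  have ha : ∀ᵐ t : ℝ, t ≠ a := by simp [ae_iff]
  have hb : ∀ᵐ t : ℝ, t ≠ b := by simp [ae_iff]
  filter_upwards [ha, hb] with t hta htb htm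
  exact ⟨lt_of_le_of_ne htm.1 (Ne.symm hta), lt_of_le_of_ne htm.2 htb⟩

/-- Absolute continuity passes to functions with smaller increments. -/
theorem absolutelyContinuousOnInterval_of_dist_le {X Y : Type*} [PseudoMetricSpace X]
    [PseudoMetricSpace Y] {a b : ℝ} {f : ℝ → X} {g : ℝ → Y}
    (hg : AbsolutelyContinuousOnInterval g a b)
    (h : ∀ x ∈ uIcc a b, ∀ y ∈ uIcc a b, dist (f x) (f y) ≤ dist (g x) (g y)) :
    AbsolutelyContinuousOnInterval f a b := by
  rw [absolutelyContinuousOnInterval_iff] at hg ⊢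
  intro ε hε
  obtain ⟨δ, hδ, H⟩ := hg ε hε
  refine ⟨δ, hδ, fun I hI hs => lt_of_le_of_lt ?_ (H I hI hs)⟩
  refine Finset.sum_le_sum fun i hi => ?_
  have := hI.1 i hi
  exact h _ this.1 _ this.2

/-- `f` is a primitive on `[a, b]` of the integrable function `f'`. -/
structure IsPrimitive (a b : ℝ) (f f' : ℝ → E) : Prop where
  integrable : IntervalIntegrable f' volume a b
  eq : ∀ t ∈ Icc a b, f t = f a + ∫ x in a..t, f' x

/-- The increments of `f` are dominated by those of the real function `∫ ‖f'‖`, which reduces vector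
values to the scalar case. -/
theorem IsPrimitive.ac {a b : ℝ} {f f' : ℝ → E} (hab : a ≤ b) (h : IsPrimitive a b f f') :
    AbsolutelyContinuousOnInterval f a b := by
  refine absolutelyContinuousOnInterval_of_dist_le
    (h.integrable.norm.absolutelyContinuousOnInterval_intervalIntegral (c := a) left_mem_uIcc) ?_
  intro x hx y hy
  rw [uIcc_of_le hab] at hx hy
  have hi := h.integrable
  have ha : a ∈ Icc a b := left_mem_Icc.2 hab
  rw [h.eq x hx, h.eq y hy, dist_add_left, dist_eq_norm, Real.dist_eq,
    intervalIntegral.integral_interval_sub_left (intervalIntegrable_mono_Icc hi ha hx)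
      (intervalIntegrable_mono_Icc hi ha hy),
    intervalIntegral.integral_interval_sub_left (intervalIntegrable_mono_Icc hi.norm ha hx)
      (intervalIntegrable_mono_Icc hi.norm ha hy)]
  exact intervalIntegral.norm_integral_le_abs_integral_norm

theorem IsPrimitive.continuousOn {a b : ℝ} {f f' : ℝ → E} (hab : a ≤ b)
    (h : IsPrimitive a b f f') : ContinuousOn f (Icc a b) := by
  simpa [uIcc_of_le hab] using (h.ac hab).continuousOn

theorem IsPrimitive.integral {a b : ℝ} {f' : ℝ → E} (hi : IntervalIntegrable f' volume a b) :
    IsPrimitive a b (fun x => ∫ s in a..x, f' s) f' := ⟨hi, fun t _ => by simp⟩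

theorem IsPrimitive.add {a b : ℝ} {f f' g g' : ℝ → E} (hab : a ≤ b) (hf : IsPrimitive a b f f')
    (hg : IsPrimitive a b g g') :
    IsPrimitive a b (fun t => f t + g t) (fun t => f' t + g' t) := by
  refine ⟨hf.integrable.add hg.integrable, fun t ht => ?_⟩
  have ha : a ∈ Icc a b := left_mem_Icc.2 hab
  rw [intervalIntegral.integral_add (intervalIntegrable_mono_Icc hf.integrable ha ht)
    (intervalIntegrable_mono_Icc hg.integrable ha ht), hf.eq t ht, hg.eq t ht]
  abel

theorem IsPrimitive.sub {a b : ℝ} {f f' g g' : ℝ → E} (hab : a ≤ b) (hf : IsPrimitive a b f f')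
    (hg : IsPrimitive a b g g') :
    IsPrimitive a b (fun t => f t - g t) (fun t => f' t - g' t) := by
  refine ⟨hf.integrable.sub hg.integrable, fun t ht => ?_⟩
  have ha : a ∈ Icc a b := left_mem_Icc.2 hab
  rw [intervalIntegral.integral_sub (intervalIntegrable_mono_Icc hf.integrable ha ht)
    (intervalIntegrable_mono_Icc hg.integrable ha ht), hf.eq t ht, hg.eq t ht]
  abel

variable [CompleteSpace E]

theorem IsPrimitive.ae_hasDerivAt {a b : ℝ} {f f' : ℝ → E} (hab : a ≤ b)
    (h : IsPrimitive a b f f') : ∀ᵐ t ∂(leb a b), HasDerivAt f (f' t) t := by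
  have h1 := h.integrable.ae_hasDerivAt_integral
  rw [uIcc_of_le hab] at h1
  have h2 : ∀ᵐ t ∂(leb a b), ∀ c ∈ Icc a b,
      HasDerivAt (fun x => ∫ (t : ℝ) in c..x, f' t) (f' t) t :=
    (ae_restrict_iff' measurableSet_Icc).2 h1
  filter_upwards [h2, ae_leb_mem_Ioo a b] with t ht hm
  have h3 := (ht a (left_mem_Icc.2 hab)).const_add (f a)
  refine h3.congr_of_eventuallyEq ?_
  filter_upwards [Icc_mem_nhds hm.1 hm.2] with s hs using h.eq s hs

/-- The difference of `f` and the integral of `f'` is absolutely continuous with derivative zero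
almost everywhere, hence constant. -/
theorem IsPrimitive.of_ac {a b : ℝ} {f f' : ℝ → E} (hab : a ≤ b)
    (hf : AbsolutelyContinuousOnInterval f a b)
    (hd : ∀ᵐ t ∂(leb a b), HasDerivAt f (f' t) t) (hi : IntervalIntegrable f' volume a b) :
    IsPrimitive a b f f' := by
  refine ⟨hi, fun t ht => ?_⟩
  have hp : IsPrimitive a b (fun x => ∫ s in a..x, f' s) f' := ⟨hi, fun t _ => by simp⟩
  have hac := hf.fun_sub (hp.ac hab)
  have hz : ∀ᵐ x, x ∈ uIcc a b → HasDerivAt (fun x => f x - ∫ s in a..x, f' s) 0 x := by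
    rw [uIcc_of_le hab, ← ae_restrict_iff' measurableSet_Icc]
    filter_upwards [hd, hp.ae_hasDerivAt hab] with x h1 h2
    simpa using h1.fun_sub h2
  obtain ⟨C, hC⟩ := hac.const_of_ae_hasDerivAt_zero hz
  rw [uIcc_of_le hab] at hC
  have h1 := hC t ht
  have h2 := hC a (left_mem_Icc.2 hab)
  simp only [intervalIntegral.integral_same, sub_zero] at h2
  rw [h2, ← h1]
  abel

/-- The product rule survives because products of absolutely continuous functions are absolutely
continuous. Integration by parts, Lagrange's identity and variation of constants all rest on it. -/
theorem IsPrimitive.smul {𝕜 : Type*} [RCLike 𝕜] [NormedSpace 𝕜 E] [IsScalarTower ℝ 𝕜 E]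
    {a b : ℝ} {f f' : ℝ → 𝕜} {g g' : ℝ → E} (hab : a ≤ b)
    (hf : IsPrimitive a b f f') (hg : IsPrimitive a b g g') :
    IsPrimitive a b (fun t => f t • g t) (fun t => f t • g' t + f' t • g t) := by
  refine IsPrimitive.of_ac hab ((hf.ac hab).fun_smul (hg.ac hab)) ?_ ?_
  · filter_upwards [hf.ae_hasDerivAt hab, hg.ae_hasDerivAt hab] with t h1 h2
    exact h1.smul h2
  · have cf := hf.continuousOn hab
    have cg := hg.continuousOn hab
    rw [← uIcc_of_le hab] at cf cg
    exact (hg.integrable.continuousOn_smul cf).add (hf.integrable.smul_continuousOn cg)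

theorem IsPrimitive.congr_ae {a b : ℝ} {f f' g' : ℝ → E} (hab : a ≤ b)
    (hf : IsPrimitive a b f f') (h : f' =ᵐ[leb a b] g') : IsPrimitive a b f g' := by
  have hi : IntervalIntegrable g' volume a b := by
    have := (intervalIntegrable_iff_integrableOn_Icc_of_le hab).1 hf.integrable
    exact intervalIntegrable_of_integrable_leb hab (Integrable.congr this h)
  refine .of_ac hab (hf.ac hab) ?_ hi
  filter_upwards [hf.ae_hasDerivAt hab, h] with t h1 h2
  rwa [← h2]

theorem IsPrimitive.eq_of_deriv_zero {a b : ℝ} {f f' : ℝ → E} (hab : a ≤ b)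
    (hf : IsPrimitive a b f f') (h : f' =ᵐ[leb a b] 0) {t : ℝ} (ht : t ∈ Icc a b) :
    f t = f a := by
  rw [(hf.congr_ae hab h).eq t ht]
  simp

theorem IsPrimitive.comp_clm {F : Type*} [NormedAddCommGroup F] [NormedSpace ℝ F]
    [CompleteSpace F] {a b : ℝ} {f f' : ℝ → E} (hab : a ≤ b) (hf : IsPrimitive a b f f')
    (L : E →L[ℝ] F) : IsPrimitive a b (fun t => L (f t)) (fun t => L (f' t)) := by
  refine ⟨?_, fun t ht => ?_⟩
  · rw [intervalIntegrable_iff] at *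
    exact L.integrable_comp (intervalIntegrable_iff.1 hf.integrable)
  · rw [L.intervalIntegral_comp_comm
      (intervalIntegrable_mono_Icc hf.integrable (left_mem_Icc.2 hab) ht), hf.eq t ht, map_add]

/-- Integration by parts bounds `∫ r z` by the primitive of `r`. -/
theorem norm_integral_smul_le {𝕜 : Type*} [RCLike 𝕜] [NormedSpace 𝕜 E] [IsScalarTower ℝ 𝕜 E]
    {a b δ : ℝ} {r : ℝ → 𝕜} {z z' : ℝ → E} (hab : a ≤ b)
    (hr : IntervalIntegrable r volume a b) (hz : IsPrimitive a b z z')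
    (hδ : ∀ t ∈ Icc a b, ‖∫ s in a..t, r s‖ ≤ δ) {t : ℝ} (ht : t ∈ Icc a b) :
    ‖∫ s in a..t, r s • z s‖ ≤ δ * (‖z t‖ + ∫ s in a..b, ‖z' s‖) := by
  have hR := IsPrimitive.integral hr
  have ha : a ∈ Icc a b := left_mem_Icc.2 hab
  -- Product rule for `R z` with `R = ∫ r`; the boundary term at `a` vanishes since `R a = 0`.
  have h := (hR.smul hab hz).eq t ht
  have cR := hR.continuousOn hab
  have cz := hz.continuousOn hab
  rw [← uIcc_of_le hab] at cR cz
  rw [intervalIntegral.integral_add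
    (intervalIntegrable_mono_Icc (hz.integrable.continuousOn_smul cR) ha ht)
    (intervalIntegrable_mono_Icc (hr.smul_continuousOn cz) ha ht)] at h
  simp only [intervalIntegral.integral_same, zero_smul, zero_add] at h
  have h' : ∫ s in a..t, r s • z s
      = (∫ s in a..t, r s) • z t - ∫ s in a..t, (∫ x in a..s, r x) • z' s := by
    rw [h]; abel
  rw [h', mul_add]
  have hδ0 : 0 ≤ δ := (norm_nonneg _).trans (hδ a ha)
  refine (norm_sub_le _ _).trans (add_le_add ?_ ?_)
  · rw [norm_smul]
    gcongr
    exact hδ t ht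
  · have hi := hz.integrable.norm.const_mul δ
    calc ‖∫ s in a..t, (∫ x in a..s, r x) • z' s‖ ≤ ∫ s in a..t, δ * ‖z' s‖ := by
          refine intervalIntegral.norm_integral_le_of_norm_le ht.1 ?_
            (intervalIntegrable_mono_Icc hi ha ht)
          refine Eventually.of_forall fun s hs => ?_
          rw [norm_smul]
          gcongr
          exact hδ s ⟨hs.1.le, hs.2.trans ht.2⟩
      _ ≤ ∫ s in a..b, δ * ‖z' s‖ := by
          refine intervalIntegral.integral_mono_interval le_rfl ht.1 ht.2 ?_ hi
          exact Eventually.of_forall fun s => by positivity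
      _ = δ * ∫ s in a..b, ‖z' s‖ := intervalIntegral.integral_const_mul _ _

end Primitive

/-! ### Gronwall's inequality with an integrable weight -/

section Gronwall

/-- The weight `w(t) = ∫_a^t k` satisfies `∫_a^t k e^{2w} = (e^{2w(t)} - 1) / 2`. -/
theorem integral_mul_exp_primitive {a b : ℝ} {k : ℝ → ℝ} (hab : a ≤ b)
    (hk : IntervalIntegrable k volume a b) {t : ℝ} (ht : t ∈ Icc a b) :
    ∫ s in a..t, k s * Real.exp (2 * ∫ x in a..s, k x)
      = (Real.exp (2 * ∫ x in a..t, k x) - 1) / 2 := by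
  have hw := IsPrimitive.integral hk
  set w : ℝ → ℝ := fun t => ∫ x in a..t, k x with hwdef
  have hc := hw.continuousOn hab
  obtain ⟨M, hM⟩ := isCompact_Icc.exists_bound_of_continuousOn hc
  -- The exponential is Lipschitz on a half-line containing the range of `w`, and composition with
  -- it preserves absolute continuity.
  have hlip : LipschitzOnWith (Real.exp (2 * M) * 2).toNNReal (fun x => Real.exp (2 * x))
      (Iic M) := by
    refine Convex.lipschitzOnWith_of_nnnorm_hasDerivWithin_le (convex_Iic M)
      (f' := fun x => Real.exp (2 * x) * 2) (fun x _ => ?_) fun x hx => ?_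
    · have := ((hasDerivAt_id x).const_mul (2 : ℝ)).exp
      simpa using this.hasDerivWithinAt
    · rw [← NNReal.coe_le_coe, Real.coe_toNNReal _ (by positivity), coe_nnnorm, Real.norm_eq_abs,
        abs_of_pos (by positivity)]
      gcongr
      exact hx
  have hmem : ∀ t ∈ Icc a b, w t ∈ Iic M := fun t ht => (le_abs_self _).trans (hM t ht)
  have hac : AbsolutelyContinuousOnInterval (fun t => Real.exp (2 * w t)) a b := by
    refine absolutelyContinuousOnInterval_of_dist_le
      ((hw.ac hab).const_smul (Real.exp (2 * M) * 2)) ?_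
    intro x hx y hy
    rw [uIcc_of_le hab] at hx hy
    refine (hlip.dist_le_mul _ (hmem x hx) _ (hmem y hy)).trans ?_
    rw [Real.coe_toNNReal _ (by positivity), dist_smul₀, Real.norm_eq_abs,
      abs_of_pos (by positivity)]
  have hce : ContinuousOn (fun t => Real.exp (2 * w t)) (Icc a b) := by fun_prop
  have hi : IntervalIntegrable (fun s => 2 * (k s * Real.exp (2 * w s))) volume a b := by
    rw [← uIcc_of_le hab] at hce
    exact (hk.mul_continuousOn hce).const_mul 2
  have hp : IsPrimitive a b (fun t => Real.exp (2 * w t))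
      (fun s => 2 * (k s * Real.exp (2 * w s))) := by
    refine .of_ac hab hac ?_ hi
    filter_upwards [hw.ae_hasDerivAt hab] with t h
    have := (h.const_mul 2).exp
    rwa [show Real.exp (2 * w t) * (2 * k t) = 2 * (k t * Real.exp (2 * w t)) by ring] at this
  have := hp.eq t ht
  rw [intervalIntegral.integral_const_mul] at this
  simp only [hwdef, intervalIntegral.integral_same, mul_zero, Real.exp_zero] at this ⊢
  linarith

/-- Gronwall's inequality with an integrable weight. -/
theorem gronwall_integral {a b δ : ℝ} {k v : ℝ → ℝ} (hab : a ≤ b)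
    (hk : IntervalIntegrable k volume a b) (hk0 : ∀ t, 0 ≤ k t) (hv : ContinuousOn v (Icc a b))
    (hδ : 0 ≤ δ) (h : ∀ t ∈ Icc a b, v t ≤ δ + ∫ s in a..t, k s * v s) {t : ℝ}
    (ht : t ∈ Icc a b) : v t ≤ 2 * δ * Real.exp (2 * ∫ s in a..b, k s) := by
  set w : ℝ → ℝ := fun t => ∫ x in a..t, k x with hwdef
  have hw : ContinuousOn w (Icc a b) := (IsPrimitive.integral hk).continuousOn hab
  have ha : a ∈ Icc a b := left_mem_Icc.2 hab
  have hw0 : ∀ t ∈ Icc a b, 0 ≤ w t := fun t ht =>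
    intervalIntegral.integral_nonneg ht.1 fun s _ => hk0 s
  have hwb : ∀ t ∈ Icc a b, w t ≤ w b := fun t ht =>
    intervalIntegral.integral_mono_interval le_rfl ht.1 ht.2 (Eventually.of_forall hk0) hk
  have hce : ContinuousOn (fun t => Real.exp (2 * w t)) (Icc a b) := by fun_prop
  have hcm : ContinuousOn (fun t => Real.exp (-(2 * w t)) * v t) (Icc a b) := by fun_prop
  -- Instead of iterating, the inequality is evaluated at a maximum point of `e^{-2w} v`. The factor
  -- 2 in the exponent makes the integral term contribute at most about half of the left side.
  obtain ⟨τ, hτ, hmax⟩ := isCompact_Icc.exists_isMaxOn ⟨a, ha⟩ hcm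
  set m := Real.exp (-(2 * w τ)) * v τ with hm
  have hvm : ∀ s ∈ Icc a b, v s ≤ m * Real.exp (2 * w s) := fun s hs => by
    have h1 : Real.exp (-(2 * w s)) * v s ≤ m := hmax hs
    calc v s = (Real.exp (-(2 * w s)) * v s) * Real.exp (2 * w s) := by
          rw [mul_right_comm, ← Real.exp_add]; simp
      _ ≤ _ := by gcongr
  have hint : ∫ s in a..τ, k s * v s ≤ m * ((Real.exp (2 * w τ) - 1) / 2) := by
    rw [← integral_mul_exp_primitive hab hk hτ, ← intervalIntegral.integral_const_mul]
    rw [← uIcc_of_le hab] at hce hv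
    refine intervalIntegral.integral_mono_on hτ.1
      (intervalIntegrable_mono_Icc (hk.mul_continuousOn hv) ha hτ)
      (intervalIntegrable_mono_Icc ((hk.mul_continuousOn hce).const_mul m) ha hτ) fun s hs => ?_
    have := mul_le_mul_of_nonneg_left (hvm s ⟨hs.1, hs.2.trans hτ.2⟩) (hk0 s)
    simp only [hwdef] at this
    linarith
  have hτv : v τ = m * Real.exp (2 * w τ) := by
    rw [hm, mul_right_comm, ← Real.exp_add]; simp
  have h1 := h τ hτ
  have he : 1 ≤ Real.exp (2 * w τ) := Real.one_le_exp (by linarith [hw0 τ hτ])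
  -- With `e = exp (2 w(τ)) ≥ 1` the inequality at `τ` reads `m e ≤ δ + m (e - 1) / 2`.
  have hm2 : m ≤ 2 * δ := by
    rcases le_or_gt m 0 with h0 | h0
    · linarith
    · nlinarith
  calc v t ≤ m * Real.exp (2 * w t) := hvm t ht
    _ ≤ 2 * δ * Real.exp (2 * w t) := by gcongr
    _ ≤ 2 * δ * Real.exp (2 * w b) := by
        gcongr
        exact hwb t ht

end Gronwall

/-! ### Linear equations with integrable coefficients: stability and existence -/

section LinearEquation

open scoped BoundedContinuousFunction

variable {E : Type*} [NormedAddCommGroup E]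

/-- The extension of a continuous function on `[a, b]` by constants. -/
theorem exists_boundedContinuous_extension {a b : ℝ} (hab : a ≤ b) {F : ℝ → E}
    (hF : ContinuousOn F (Icc a b)) :
    ∃ G : ℝ →ᵇ E, ∀ t, G t = F (projIcc a b hab t) := by
  obtain ⟨C, hC⟩ := isCompact_Icc.exists_bound_of_continuousOn hF
  refine ⟨BoundedContinuousFunction.ofNormedAddCommGroup (fun t => F (projIcc a b hab t)) ?_ C
    fun t => hC _ (projIcc a b hab t).2, fun t => rfl⟩
  exact hF.comp_continuous (continuous_subtype_val.comp continuous_projIcc)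
    fun t => (projIcc a b hab t).2

variable [NormedSpace ℝ E]

theorem intervalIntegrable_clm_apply {a b : ℝ} (hab : a ≤ b) {A : ℝ → E →L[ℝ] E} {X : ℝ → E}
    (hA : IntervalIntegrable A volume a b) (hX : ContinuousOn X (Icc a b)) :
    IntervalIntegrable (fun s => A s (X s)) volume a b := by
  obtain ⟨C, hC⟩ := isCompact_Icc.exists_bound_of_continuousOn hX
  rw [intervalIntegrable_iff_integrableOn_Icc_of_le hab] at hA ⊢
  refine (hA.norm.mul_const C).mono' ?_ ?_
  · exact (ContinuousLinearMap.id ℝ (E →L[ℝ] E)).aestronglyMeasurable_comp₂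
      hA.aestronglyMeasurable (hX.aestronglyMeasurable measurableSet_Icc)
  · filter_upwards [ae_restrict_mem measurableSet_Icc] with s hs
    exact (A s).le_opNorm_of_le (hC s hs)

/-- Stability of linear equations: the solutions are close if `∫_a^t (A - A₀) Y₀` is small. -/
theorem norm_linear_solution_sub_le {a b δ : ℝ} (hab : a ≤ b) {A A₀ : ℝ → E →L[ℝ] E}
    (hA : IntervalIntegrable A volume a b) (hA₀ : IntervalIntegrable A₀ volume a b)
    {k : ℝ → ℝ} (hk : IntervalIntegrable k volume a b) (hAk : ∀ t, ‖A t‖ ≤ k t)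
    {c : E} {Y Y₀ : ℝ → E} (cY : ContinuousOn Y (Icc a b)) (cY₀ : ContinuousOn Y₀ (Icc a b))
    (hY : ∀ t ∈ Icc a b, Y t = c + ∫ s in a..t, A s (Y s))
    (hY₀ : ∀ t ∈ Icc a b, Y₀ t = c + ∫ s in a..t, A₀ s (Y₀ s))
    (hδ : ∀ t ∈ Icc a b, ‖∫ s in a..t, (A s - A₀ s) (Y₀ s)‖ ≤ δ) {t : ℝ} (ht : t ∈ Icc a b) :
    ‖Y t - Y₀ t‖ ≤ 2 * δ * Real.exp (2 * ∫ s in a..b, k s) := by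
  have ha : a ∈ Icc a b := left_mem_Icc.2 hab
  have hδ0 : 0 ≤ δ := (norm_nonneg _).trans (hδ a ha)
  have cZ : ContinuousOn (fun t => Y t - Y₀ t) (Icc a b) := cY.sub cY₀
  refine gronwall_integral (v := fun t => ‖Y t - Y₀ t‖) hab hk
    (fun t => (norm_nonneg _).trans (hAk t)) cZ.norm hδ0 (fun t ht => ?_) ht
  have i1 := intervalIntegrable_mono_Icc (intervalIntegrable_clm_apply hab hA cZ) ha ht
  have i2 := intervalIntegrable_mono_Icc (intervalIntegrable_clm_apply hab (hA.sub hA₀) cY₀) ha ht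
  have i3 := intervalIntegrable_mono_Icc (intervalIntegrable_clm_apply hab hA cY) ha ht
  have i4 := intervalIntegrable_mono_Icc (intervalIntegrable_clm_apply hab hA₀ cY₀) ha ht
  -- Only `A` acts on the unknown difference, so only `A` enters the Gronwall constant; `A - A₀`
  -- acts on the fixed `Y₀`.
  have e : Y t - Y₀ t = (∫ s in a..t, (A s - A₀ s) (Y₀ s)) + ∫ s in a..t, A s (Y s - Y₀ s) := by
    rw [hY t ht, hY₀ t ht, add_sub_add_left_eq_sub, ← intervalIntegral.integral_sub i3 i4,
      ← intervalIntegral.integral_add i2 i1]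
    refine intervalIntegral.integral_congr fun s _ => ?_
    simp only [sub_apply, map_sub]
    abel
  rw [e]
  refine (norm_add_le _ _).trans (add_le_add (hδ t ht) ?_)
  refine intervalIntegral.norm_integral_le_of_norm_le ht.1 (Eventually.of_forall fun s hs => ?_) ?_
  · exact (A s).le_of_opNorm_le (hAk s) _
  · have := cZ.norm
    rw [← uIcc_of_le hab] at this
    exact intervalIntegrable_mono_Icc (hk.mul_continuousOn this) ha ht

variable [CompleteSpace E]

/-- The initial value problem `Y' = A Y`, `Y(a) = c` with an integrable coefficient. -/
theorem exists_linear_solution {a b : ℝ} (hab : a ≤ b) {A : ℝ → E →L[ℝ] E}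
    (hA : IntervalIntegrable A volume a b) (c : E) :
    ∃ Y : ℝ →ᵇ E, (∀ t, Y t = Y (projIcc a b hab t)) ∧
      ∀ t ∈ Icc a b, Y t = c + ∫ s in a..t, A s (Y s) := by
  set w : ℝ → ℝ := fun t => ∫ x in a..t, ‖A x‖ with hwdef
  have ha : a ∈ Icc a b := left_mem_Icc.2 hab
  have hw : ContinuousOn w (Icc a b) := (IsPrimitive.integral hA.norm).continuousOn hab
  have hce : ContinuousOn (fun t => Real.exp (2 * w t)) (Icc a b) := by fun_prop
  have hce' : ContinuousOn (fun t => Real.exp (-(2 * w t))) (Icc a b) := by fun_prop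
  have hi : ∀ X : ℝ →ᵇ E,
      IntervalIntegrable (fun s => Real.exp (2 * w s) • A s (X s)) volume a b := fun X => by
    have := intervalIntegrable_clm_apply hab hA X.continuous.continuousOn
    rw [← uIcc_of_le hab] at hce
    exact this.continuousOn_smul hce
  -- The Picard operator conjugated by the weight `e^{2w}`, acting on `X = e^{-2w} Y`. The weight
  -- makes it a contraction with constant 1/2 on the whole interval at once, however large `∫ ‖A‖`
  -- is.
  have hT : ∀ X : ℝ →ᵇ E, ∃ G : ℝ →ᵇ E, ∀ t, G t = (fun τ => Real.exp (-(2 * w τ)) •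
      (c + ∫ s in a..τ, Real.exp (2 * w s) • A s (X s))) (projIcc a b hab t) := fun X => by
    refine exists_boundedContinuous_extension hab (F := fun τ => Real.exp (-(2 * w τ)) •
      (c + ∫ s in a..τ, Real.exp (2 * w s) • A s (X s))) ?_
    exact hce'.smul (continuousOn_const.add ((IsPrimitive.integral (hi X)).continuousOn hab))
  choose T hT using hT
  have hcontr : ContractingWith (1 / 2 : NNReal) T := by
    refine ⟨by rw [← NNReal.coe_lt_coe]; norm_num, LipschitzWith.of_dist_le_mul fun X X' => ?_⟩
    refine (BoundedContinuousFunction.dist_le (by positivity)).2 fun t => ?_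
    have hτ := (projIcc a b hab t).2
    rw [hT, hT]
    set τ : ℝ := (projIcc a b hab t : ℝ)
    have i1 := intervalIntegrable_mono_Icc (hi X) ha hτ
    have i2 := intervalIntegrable_mono_Icc (hi X') ha hτ
    simp only
    rw [dist_eq_norm, ← smul_sub, add_sub_add_left_eq_sub, ← intervalIntegral.integral_sub i1 i2,
      norm_smul, Real.norm_eq_abs, Real.abs_exp]
    have hb : ‖∫ s in a..τ, (Real.exp (2 * w s) • A s (X s) - Real.exp (2 * w s) • A s (X' s))‖
        ≤ ∫ s in a..τ, dist X X' * (‖A s‖ * Real.exp (2 * w s)) := by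
      refine intervalIntegral.norm_integral_le_of_norm_le hτ.1 (Eventually.of_forall fun s hs => ?_)
        ?_
      · rw [← smul_sub, ← map_sub, norm_smul, Real.norm_eq_abs, Real.abs_exp]
        have h1 := (A s).le_opNorm_of_le
          ((dist_eq_norm (X s) (X' s)).symm.le.trans (X.dist_coe_le_dist s))
        nlinarith [Real.exp_pos (2 * w s)]
      · rw [← uIcc_of_le hab] at hce
        exact intervalIntegrable_mono_Icc ((hA.norm.mul_continuousOn hce).const_mul _) ha hτ
    rw [intervalIntegral.integral_const_mul, integral_mul_exp_primitive hab hA.norm hτ] at hb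
    have he : Real.exp (-(2 * w τ)) * Real.exp (2 * w τ) = 1 := by rw [← Real.exp_add]; simp
    have hp := Real.exp_pos (-(2 * w τ))
    have hd : 0 ≤ dist X X' := dist_nonneg
    calc _ ≤ Real.exp (-(2 * w τ)) * (dist X X' * ((Real.exp (2 * w τ) - 1) / 2)) := by gcongr
      _ = dist X X' / 2 * (Real.exp (-(2 * w τ)) * Real.exp (2 * w τ) - Real.exp (-(2 * w τ))) := by
          ring
      _ ≤ dist X X' / 2 * 1 := by
          gcongr
          linarith
      _ = _ := by
          push_cast
          ring
  set X := ContractingWith.fixedPoint T hcontr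
  have hfix : T X = X := hcontr.fixedPoint_isFixedPt
  have hX : ∀ t ∈ Icc a b, X t = Real.exp (-(2 * w t)) •
      (c + ∫ s in a..t, Real.exp (2 * w s) • A s (X s)) := fun t ht => by
    have := hT X t
    rwa [hfix, projIcc_of_mem hab ht] at this
  -- Removing the weight from the fixed point gives the solution.
  obtain ⟨Y, hY⟩ := exists_boundedContinuous_extension hab
    (F := fun t => Real.exp (2 * w t) • X t) (hce.smul X.continuous.continuousOn)
  have hYI : ∀ t ∈ Icc a b, Y t = Real.exp (2 * w t) • X t := fun t ht => by
    rw [hY, projIcc_of_mem hab ht]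
  refine ⟨Y, fun t => ?_, fun t ht => ?_⟩
  · rw [hY, hYI _ (projIcc a b hab t).2]
  · rw [hYI t ht, hX t ht, smul_smul, ← Real.exp_add, add_neg_cancel, Real.exp_zero, one_smul]
    congr 1
    refine intervalIntegral.integral_congr fun s hs => ?_
    rw [uIcc_of_le ht.1] at hs
    rw [hYI s ⟨hs.1, hs.2.trans ht.2⟩, map_smul]

end LinearEquation

/-! ### The first order system, variation of constants and the boundary condition -/

section System

/-- `(y, u)` solves the first order system equivalent to `-y'' + q' y - μ y = f`, `u = D^[1] y`. -/
structure SolvesSystem (a b : ℝ) (q : ℝ → ℂ) (μ : ℂ) (f y u : ℝ → ℂ) : Prop where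
  fst : IsPrimitive a b y (fun t => q t * y t + u t)
  snd : IsPrimitive a b u (fun t => -(q t * u t) - q t ^ 2 * y t - μ * y t - f t)

theorem intervalIntegrable_of_memLp {a b : ℝ} (hab : a ≤ b) {q : ℝ → ℂ}
    (hq : MemLp q 2 (leb a b)) : IntervalIntegrable q volume a b :=
  intervalIntegrable_of_integrable_leb hab (hq.integrable one_le_two)

theorem intervalIntegrable_sq_of_memLp {a b : ℝ} (hab : a ≤ b) {q : ℝ → ℂ}
    (hq : MemLp q 2 (leb a b)) : IntervalIntegrable (fun t => q t ^ 2) volume a b := by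
  refine intervalIntegrable_of_integrable_leb hab ?_
  simpa only [sq] using! hq.integrable_mul hq

theorem SolvesSystem.hasQuasiDerivs {a b : ℝ} (hab : a ≤ b) {q : ℝ → ℂ} {μ : ℂ} {f y u : ℝ → ℂ}
    (h : SolvesSystem a b q μ f y u) :
    HasQuasiDerivs a b q y u (fun t => μ * y t + f t) := by
  refine ⟨h.fst.ac hab, h.snd.ac hab, ?_, ?_⟩
  · filter_upwards [h.fst.ae_hasDerivAt hab] with t ht
    rw [ht.deriv]
    ring
  · filter_upwards [h.snd.ae_hasDerivAt hab] with t ht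
    rw [ht.deriv]
    ring

/-- The definitions of the quasi-derivatives are solved for `y'` and `u'`. Square integrability of
`q` makes both right-hand sides integrable, so `y` and `u` are primitives of them. -/
theorem HasQuasiDerivs.solvesSystem {a b : ℝ} (hab : a ≤ b) {q : ℝ → ℂ}
    (hq : MemLp q 2 (leb a b)) (μ : ℂ) {f y u g : ℝ → ℂ} (h : HasQuasiDerivs a b q y u g)
    (hg : IntervalIntegrable g volume a b) (hf : f =ᵐ[leb a b] fun t => g t - μ * y t) :
    SolvesSystem a b q μ f y u := by
  have cy := h.ac_zero.continuousOn
  have cu := h.ac_one.continuousOn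
  have hq1 := intervalIntegrable_of_memLp hab hq
  have hq2 := intervalIntegrable_sq_of_memLp hab hq
  have i1 : IsPrimitive a b y (fun t => q t * y t + u t) := by
    refine .of_ac hab h.ac_zero ?_ ((hq1.mul_continuousOn cy).add cu.intervalIntegrable)
    filter_upwards [ae_differentiableAt_of_ac h.ac_zero, h.deriv_one] with t h1 h2
    rw [h2, add_sub_cancel]
    exact h1.hasDerivAt
  have i2 : IsPrimitive a b u (fun t => -(q t * u t) - q t ^ 2 * y t - g t) := by
    refine .of_ac hab h.ac_one ?_
      (((hq1.mul_continuousOn cu).neg.sub (hq2.mul_continuousOn cy)).sub hg)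
    filter_upwards [ae_differentiableAt_of_ac h.ac_one, h.deriv_two] with t h1 h2
    rw [h2]
    convert h1.hasDerivAt using 1
    ring
  refine ⟨i1, i2.congr_ae hab ?_⟩
  filter_upwards [hf] with t h1
  rw [h1]
  ring

/-- Lagrange's identity. -/
theorem SolvesSystem.lagrange {a b : ℝ} (hab : a ≤ b) {q : ℝ → ℂ} {μ : ℂ}
    {f y u z v : ℝ → ℂ} (h : SolvesSystem a b q μ f y u) (h' : SolvesSystem a b q μ 0 z v) :
    IsPrimitive a b (fun t => y t * v t - u t * z t) (fun t => f t * z t) := by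
  have := (h.fst.smul hab h'.snd).sub hab (h.snd.smul hab h'.fst)
  refine this.congr_ae hab (Eventually.of_forall fun t => ?_)
  simp only [smul_eq_mul, Pi.zero_apply]
  ring

/-- `(φ₀, φ₁)`, `(ψ₀, ψ₁)` is the fundamental system of solutions normalized at `a`. -/
structure IsFundamentalSystem (a b : ℝ) (q : ℝ → ℂ) (μ : ℂ) (φ₀ φ₁ ψ₀ ψ₁ : ℝ → ℂ) : Prop where
  solves_left : SolvesSystem a b q μ 0 φ₀ φ₁
  solves_right : SolvesSystem a b q μ 0 ψ₀ ψ₁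
  left_zero : φ₀ a = 1
  left_one : φ₁ a = 0
  right_zero : ψ₀ a = 0
  right_one : ψ₁ a = 1

variable {a b : ℝ} {q : ℝ → ℂ} {μ : ℂ} {φ₀ φ₁ ψ₀ ψ₁ : ℝ → ℂ}

/-- Lagrange's identity with zero source: the Wronskian is constant, and it is 1 at `a`. -/
theorem IsFundamentalSystem.wronskian (hab : a ≤ b)
    (h : IsFundamentalSystem a b q μ φ₀ φ₁ ψ₀ ψ₁) {t : ℝ} (ht : t ∈ Icc a b) :
    φ₀ t * ψ₁ t - φ₁ t * ψ₀ t = 1 := by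
  have := (h.solves_left.lagrange hab h.solves_right).eq_of_deriv_zero hab
    (Eventually.of_forall fun t => by simp) ht
  simpa [h.left_zero, h.left_one, h.right_zero, h.right_one] using this

/-- Variation of constants: every solution has the expected form. -/
theorem IsFundamentalSystem.representation (hab : a ≤ b)
    (h : IsFundamentalSystem a b q μ φ₀ φ₁ ψ₀ ψ₁) {f y u : ℝ → ℂ}
    (hy : SolvesSystem a b q μ f y u) {t : ℝ} (ht : t ∈ Icc a b) :
    y t = φ₀ t * (y a + ∫ s in a..t, f s * ψ₀ s) + ψ₀ t * (u a - ∫ s in a..t, f s * φ₀ s) ∧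
    u t = φ₁ t * (y a + ∫ s in a..t, f s * ψ₀ s) + ψ₁ t * (u a - ∫ s in a..t, f s * φ₀ s) := by
  have w := h.wronskian hab ht
  have h1 := (hy.lagrange hab h.solves_left).eq t ht
  have h2 := (hy.lagrange hab h.solves_right).eq t ht
  -- Lagrange's identity against each basis solution gives two linear equations for `y t` and `u t`,
  -- with the Wronskian as determinant.
  simp only [h.left_zero, h.left_one, h.right_zero, h.right_one] at h1 h2
  constructor
  · linear_combination (-y t) * w + φ₀ t * h2 - ψ₀ t * h1
  · linear_combination (-u t) * w + φ₁ t * h2 - ψ₁ t * h1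

/-- Variation of constants: the expected form gives a solution. -/
theorem IsFundamentalSystem.solvesSystem (hab : a ≤ b)
    (h : IsFundamentalSystem a b q μ φ₀ φ₁ ψ₀ ψ₁) {f : ℝ → ℂ}
    (hf : IntervalIntegrable f volume a b) (c d : ℂ) :
    SolvesSystem a b q μ f
      (fun t => φ₀ t * (c + ∫ s in a..t, f s * ψ₀ s) + ψ₀ t * (d - ∫ s in a..t, f s * φ₀ s))
      (fun t => φ₁ t * (c + ∫ s in a..t, f s * ψ₀ s) + ψ₁ t * (d - ∫ s in a..t, f s * φ₀ s)) := by
  have cφ := h.solves_left.fst.continuousOn hab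
  have cψ := h.solves_right.fst.continuousOn hab
  rw [← uIcc_of_le hab] at cφ cψ
  have hconst : ∀ c : ℂ, IsPrimitive a b (fun _ => c) (fun _ => (0 : ℂ)) := fun c =>
    ⟨intervalIntegrable_const, fun t _ => by simp⟩
  have p1 := (hconst c).add hab (IsPrimitive.integral (hf.mul_continuousOn cψ))
  have p2 := (hconst d).sub hab (IsPrimitive.integral (hf.mul_continuousOn cφ))
  constructor
  · refine ((h.solves_left.fst.smul hab p1).add hab (h.solves_right.fst.smul hab p2)).congr_ae hab
      (Eventually.of_forall fun t => ?_)
    simp only [smul_eq_mul]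
    ring
  · refine ((h.solves_left.snd.smul hab p1).add hab (h.solves_right.snd.smul hab p2)).congr_ae hab ?_
    filter_upwards [ae_restrict_mem measurableSet_Icc] with t ht
    -- The terms with `f` cancel identically in the first equation; here they leave `f` times the
    -- Wronskian with a minus sign.
    have w := h.wronskian hab ht
    simp only [smul_eq_mul, Pi.zero_apply]
    linear_combination (-f t) * w

/-- The value at `t` of the fundamental matrix. -/
def fundamentalMatrix (φ₀ φ₁ ψ₀ ψ₁ : ℝ → ℂ) (t : ℝ) : Matrix (Fin 2) (Fin 2) ℂ :=
  !![φ₀ t, ψ₀ t; φ₁ t, ψ₁ t]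

/-- The matrix of the boundary condition in the coordinates given by a fundamental matrix with
the value `Φ` at `b`. -/
def boundaryMatrix (α β Φ : Matrix (Fin 2) (Fin 2) ℂ) : Matrix (Fin 2) (Fin 2) ℂ := α + β * Φ

/-- The matrix of the map from the coefficients of the particular solution at `b` to the initial
values of the solution of the boundary problem. -/
noncomputable def correctionMatrix (α β Φ : Matrix (Fin 2) (Fin 2) ℂ) :
    Matrix (Fin 2) (Fin 2) ℂ := -((boundaryMatrix α β Φ)⁻¹ * (β * Φ))

/-- Variation of constants at `b` says `𝒴_b = Φ (𝒴_a + J)`, where `J` holds the integrals of `f`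
against the basis. Hence the unknown initial values enter only through `α + β Φ`. -/
theorem IsFundamentalSystem.boundary_eq (hab : a ≤ b)
    (h : IsFundamentalSystem a b q μ φ₀ φ₁ ψ₀ ψ₁) (α β : Matrix (Fin 2) (Fin 2) ℂ)
    {f y u : ℝ → ℂ} (hy : SolvesSystem a b q μ f y u) :
    α *ᵥ ![y a, u a] + β *ᵥ ![y b, u b] =
      boundaryMatrix α β (fundamentalMatrix φ₀ φ₁ ψ₀ ψ₁ b) *ᵥ ![y a, u a] +
      (β * fundamentalMatrix φ₀ φ₁ ψ₀ ψ₁ b) *ᵥ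
        ![∫ s in a..b, f s * ψ₀ s, -∫ s in a..b, f s * φ₀ s] := by
  set Φ := fundamentalMatrix φ₀ φ₁ ψ₀ ψ₁ b with hΦ
  set J : Fin 2 → ℂ := ![∫ s in a..b, f s * ψ₀ s, -∫ s in a..b, f s * φ₀ s] with hJ
  obtain ⟨e1, e2⟩ := h.representation hab hy (right_mem_Icc.2 hab)
  have e : ![y b, u b] = Φ *ᵥ (![y a, u a] + J) := by
    ext i
    fin_cases i
    · simp [hΦ, hJ, fundamentalMatrix, Matrix.mulVec, e1, sub_eq_add_neg]
    · simp [hΦ, hJ, fundamentalMatrix, Matrix.mulVec, e2, sub_eq_add_neg]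
  rw [e, Matrix.mulVec_mulVec, Matrix.mulVec_add, boundaryMatrix, Matrix.add_mulVec, add_assoc]

theorem IsFundamentalSystem.boundaryCondition_iff (hab : a ≤ b)
    (h : IsFundamentalSystem a b q μ φ₀ φ₁ ψ₀ ψ₁) {α β : Matrix (Fin 2) (Fin 2) ℂ}
    (hdet : (boundaryMatrix α β (fundamentalMatrix φ₀ φ₁ ψ₀ ψ₁ b)).det ≠ 0) {f y u : ℝ → ℂ}
    (hy : SolvesSystem a b q μ f y u) :
    BoundaryCondition a b α β y u ↔
      ![y a, u a] = correctionMatrix α β (fundamentalMatrix φ₀ φ₁ ψ₀ ψ₁ b) *ᵥ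
        ![∫ s in a..b, f s * ψ₀ s, -∫ s in a..b, f s * φ₀ s] := by
  unfold BoundaryCondition
  rw [h.boundary_eq hab α β hy, correctionMatrix, Matrix.neg_mulVec]
  set M := boundaryMatrix α β (fundamentalMatrix φ₀ φ₁ ψ₀ ψ₁ b)
  generalize β * fundamentalMatrix φ₀ φ₁ ψ₀ ψ₁ b = B
  have hu : IsUnit M.det := isUnit_iff_ne_zero.2 hdet
  rw [← Matrix.mulVec_mulVec]
  constructor
  · intro h0
    have h1 := congrArg (M⁻¹ *ᵥ ·) h0
    simp only [Matrix.mulVec_add, Matrix.mulVec_zero] at h1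
    rw [Matrix.mulVec_mulVec, Matrix.nonsing_inv_mul _ hu, Matrix.one_mulVec] at h1
    exact eq_neg_of_add_eq_zero_left h1
  · intro h0
    rw [h0, Matrix.mulVec_neg, Matrix.mulVec_mulVec, Matrix.mul_nonsing_inv _ hu,
      Matrix.one_mulVec, neg_add_cancel]

end System

/-! ### The Green kernel -/

section Kernel

open scoped BoundedContinuousFunction

/-- The function `(t, s) ↦ x(t) y(s)`. -/
noncomputable def tensor (x y : ℝ →ᵇ ℂ) : ℝ × ℝ →ᵇ ℂ :=
  x.compContinuous ⟨Prod.fst, continuous_fst⟩ * y.compContinuous ⟨Prod.snd, continuous_snd⟩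

@[simp]
theorem tensor_apply (x y : ℝ →ᵇ ℂ) (p : ℝ × ℝ) : tensor x y p = x p.1 * y p.2 := rfl

/-- The part of the Green function which is supported on `s ≤ t`. -/
noncomputable def causalPart (φ ψ : ℝ →ᵇ ℂ) : ℝ × ℝ →ᵇ ℂ := tensor φ ψ - tensor ψ φ

/-- The continuous part of the Green function. -/
noncomputable def smoothPart (φ ψ : ℝ →ᵇ ℂ) (N : Matrix (Fin 2) (Fin 2) ℂ) : ℝ × ℝ →ᵇ ℂ :=
  tensor (N 0 0 • φ + N 1 0 • ψ) ψ - tensor (N 0 1 • φ + N 1 1 • ψ) φ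

/-- The Green function in terms of the fundamental system and the correction matrix. -/
noncomputable def greenKernel (φ ψ : ℝ →ᵇ ℂ) (N : Matrix (Fin 2) (Fin 2) ℂ) (p : ℝ × ℝ) : ℂ :=
  {p : ℝ × ℝ | p.2 ≤ p.1}.indicator (causalPart φ ψ) p + smoothPart φ ψ N p

theorem measurable_greenKernel (φ ψ : ℝ →ᵇ ℂ) (N : Matrix (Fin 2) (Fin 2) ℂ) :
    Measurable (greenKernel φ ψ N) := by
  refine Measurable.add (Measurable.indicator ?_ ?_) ?_
  · exact (causalPart φ ψ).continuous.measurable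
  · exact measurableSet_le measurable_snd measurable_fst
  · exact (smoothPart φ ψ N).continuous.measurable

/-- All kernels jump across the same diagonal, so the cut-off does not spoil the comparison of the
continuous factors in the sup norm. -/
theorem norm_greenKernel_sub_le (φ ψ φ' ψ' : ℝ →ᵇ ℂ) (N N' : Matrix (Fin 2) (Fin 2) ℂ)
    (p : ℝ × ℝ) : ‖greenKernel φ ψ N p - greenKernel φ' ψ' N' p‖
      ≤ ‖causalPart φ ψ - causalPart φ' ψ'‖ + ‖smoothPart φ ψ N - smoothPart φ' ψ' N'‖ := by
  rw [greenKernel, greenKernel, add_sub_add_comm]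
  refine (norm_add_le _ _).trans (add_le_add ?_ ?_)
  · have := (causalPart φ ψ - causalPart φ' ψ').norm_coe_le_norm p
    by_cases hp : p ∈ {p : ℝ × ℝ | p.2 ≤ p.1}
    · rwa [indicator_of_mem hp, indicator_of_mem hp]
    · simp only [indicator_of_notMem hp, sub_self, norm_zero, norm_nonneg]
  · exact (smoothPart φ ψ N - smoothPart φ' ψ' N').norm_coe_le_norm p

theorem norm_greenKernel_le (φ ψ : ℝ →ᵇ ℂ) (N : Matrix (Fin 2) (Fin 2) ℂ) (p : ℝ × ℝ) :
    ‖greenKernel φ ψ N p‖ ≤ ‖causalPart φ ψ‖ + ‖smoothPart φ ψ N‖ :=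
  (norm_add_le _ _).trans (add_le_add ((norm_indicator_le_norm_self _ _).trans
    ((causalPart φ ψ).norm_coe_le_norm p)) ((smoothPart φ ψ N).norm_coe_le_norm p))

/-- The kernel is designed so that its integral against `f` is the variation of constants formula
with the initial values `N J`. -/
theorem integral_greenKernel {a b : ℝ} (φ ψ : ℝ →ᵇ ℂ) (N : Matrix (Fin 2) (Fin 2) ℂ)
    {f : ℝ → ℂ} (hf : IntervalIntegrable f volume a b) {t : ℝ} (ht : t ∈ Icc a b) :
    ∫ s in a..b, greenKernel φ ψ N (t, s) * f s =
      φ t * ((N *ᵥ ![∫ s in a..b, f s * ψ s, -∫ s in a..b, f s * φ s]) 0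
          + ∫ s in a..t, f s * ψ s) +
      ψ t * ((N *ᵥ ![∫ s in a..b, f s * ψ s, -∫ s in a..b, f s * φ s]) 1
          - ∫ s in a..t, f s * φ s) := by
  have hab : a ≤ b := ht.1.trans ht.2
  have iφ : IntervalIntegrable (fun s => f s * φ s) volume a b :=
    hf.mul_continuousOn φ.continuous.continuousOn
  have iψ : IntervalIntegrable (fun s => f s * ψ s) volume a b :=
    hf.mul_continuousOn ψ.continuous.continuousOn
  have ind : ∀ g : ℝ → ℂ, ∫ s in a..b, (Iic t).indicator g s = ∫ s in a..t, g s := fun g =>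
    intervalIntegral.integral_indicator ht
  have indi : ∀ g : ℝ → ℂ, IntervalIntegrable g volume a b →
      IntervalIntegrable ((Iic t).indicator g) volume a b := fun g hg => by
    rw [intervalIntegrable_iff] at hg ⊢
    exact hg.indicator measurableSet_Iic
  have e : ∀ s, greenKernel φ ψ N (t, s) * f s =
      (φ t * (Iic t).indicator (fun s => f s * ψ s) s
        - ψ t * (Iic t).indicator (fun s => f s * φ s) s)
      + ((N 0 0 * φ t + N 1 0 * ψ t) * (f s * ψ s)
        - (N 0 1 * φ t + N 1 1 * ψ t) * (f s * φ s)) := fun s => by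
    by_cases hs : s ≤ t <;> simp [greenKernel, causalPart, smoothPart, indicator, hs] <;> ring
  simp_rw [e]
  rw [intervalIntegral.integral_add
      (((indi _ iψ).const_mul _).sub ((indi _ iφ).const_mul _))
      ((iψ.const_mul _).sub (iφ.const_mul _)),
    intervalIntegral.integral_sub ((indi _ iψ).const_mul _) ((indi _ iφ).const_mul _),
    intervalIntegral.integral_sub (iψ.const_mul _) (iφ.const_mul _),
    intervalIntegral.integral_const_mul, intervalIntegral.integral_const_mul,
    intervalIntegral.integral_const_mul, intervalIntegral.integral_const_mul, ind, ind]
  simp [Matrix.mulVec, dotProduct]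
  ring

end Kernel

/-! ### Solution of the boundary problem by the Green kernel -/

section Green

open scoped BoundedContinuousFunction

variable {a b : ℝ} {q : ℝ → ℂ} {μ : ℂ} {φ₀ ψ₀ : ℝ →ᵇ ℂ} {φ₁ ψ₁ : ℝ → ℂ}
  {α β : Matrix (Fin 2) (Fin 2) ℂ}

/-- A solution of the boundary problem is given by the Green function. -/
theorem IsFundamentalSystem.eq_integral_greenKernel (hab : a ≤ b)
    (h : IsFundamentalSystem a b q μ φ₀ φ₁ ψ₀ ψ₁)
    (hdet : (boundaryMatrix α β (fundamentalMatrix φ₀ φ₁ ψ₀ ψ₁ b)).det ≠ 0) {f y u : ℝ → ℂ}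
    (hf : IntervalIntegrable f volume a b)
    (hy : SolvesSystem a b q μ f y u) (hbc : BoundaryCondition a b α β y u)
    {t : ℝ} (ht : t ∈ Icc a b) :
    y t = ∫ s in a..b,
      greenKernel φ₀ ψ₀ (correctionMatrix α β (fundamentalMatrix φ₀ φ₁ ψ₀ ψ₁ b)) (t, s) * f s := by
  have e := (h.boundaryCondition_iff hab hdet hy).1 hbc
  rw [integral_greenKernel _ _ _ hf ht, ← e, (h.representation hab hy ht).1]
  simp

/-- The boundary problem is solvable. -/
theorem IsFundamentalSystem.exists_solution (hab : a ≤ b)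
    (h : IsFundamentalSystem a b q μ φ₀ φ₁ ψ₀ ψ₁)
    (hdet : (boundaryMatrix α β (fundamentalMatrix φ₀ φ₁ ψ₀ ψ₁ b)).det ≠ 0) {f : ℝ → ℂ}
    (hf : IntervalIntegrable f volume a b) :
    ∃ y u, SolvesSystem a b q μ f y u ∧ BoundaryCondition a b α β y u := by
  have hs := h.solvesSystem hab hf
    ((correctionMatrix α β (fundamentalMatrix φ₀ φ₁ ψ₀ ψ₁ b) *ᵥ
        ![∫ s in a..b, f s * ψ₀ s, -∫ s in a..b, f s * φ₀ s]) 0)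
    ((correctionMatrix α β (fundamentalMatrix φ₀ φ₁ ψ₀ ψ₁ b) *ᵥ
        ![∫ s in a..b, f s * ψ₀ s, -∫ s in a..b, f s * φ₀ s]) 1)
  refine ⟨_, _, hs, (h.boundaryCondition_iff hab hdet hs).2 ?_⟩
  ext i
  fin_cases i <;> simp [h.left_zero, h.left_one, h.right_zero, h.right_one]

end Green

/-! ### Integral operators with bounded kernels -/

section KernelOperator

theorem integrable_coeFn {a b : ℝ} (f : L2 a b) : Integrable f (leb a b) :=
  (Lp.memLp f).integrable one_le_two

theorem intervalIntegral_eq_leb {a b : ℝ} (hab : a ≤ b) (g : ℝ → ℂ) :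
    ∫ s in a..b, g s = ∫ s, g s ∂(leb a b) := by
  rw [intervalIntegral.integral_of_le hab, integral_Icc_eq_integral_Ioc]

/-- An integral operator with a bounded kernel is bounded in `L_2`, with the norm controlled by
the supremum of the kernel. -/
theorem exists_kernel_operator {a b : ℝ} (hab : a ≤ b) :
    ∃ D : ℝ, ∀ (K : ℝ × ℝ → ℂ) (C : ℝ), Measurable K → (∀ p, ‖K p‖ ≤ C) →
      ∃ R : L2 a b →L[ℂ] L2 a b, ‖R‖ ≤ C * D ∧
        ∀ f : L2 a b, R f =ᵐ[leb a b] fun t => ∫ s in a..b, K (t, s) * f s := by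
  -- `D₁` bounds the embedding of `L_2` into `L_1`, and `D₂` below that of `L_∞` into `L_2`; between
  -- them the kernel maps `L_1` to `L_∞` with norm at most `C`.
  obtain ⟨D₁, hD₁⟩ : ∃ D : ℝ, 0 ≤ D ∧ ∀ f : L2 a b, ∫ s, ‖f s‖ ∂(leb a b) ≤ D * ‖f‖ := by
    refine ⟨((leb a b) univ ^ (1 / (1 : ℝ≥0∞).toReal - 1 / (2 : ℝ≥0∞).toReal)).toReal,
      ENNReal.toReal_nonneg, fun f => ?_⟩
    have h := eLpNorm_le_eLpNorm_mul_rpow_measure_univ (μ := leb a b) one_le_two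
      (Lp.aestronglyMeasurable f)
    have hfin : (leb a b) univ ^ (1 / (1 : ℝ≥0∞).toReal - 1 / (2 : ℝ≥0∞).toReal) ≠ ∞ :=
      ENNReal.rpow_ne_top_of_nonneg (by norm_num) (measure_ne_top _ _)
    rw [integral_norm_eq_lintegral_enorm (Lp.aestronglyMeasurable f), ← eLpNorm_one_eq_lintegral_enorm,
      Lp.norm_def, mul_comm, ← ENNReal.toReal_mul]
    exact ENNReal.toReal_mono (ENNReal.mul_ne_top (Lp.eLpNorm_ne_top f) hfin) h
  set D₂ : ℝ := (measureUnivNNReal (leb a b) : ℝ) ^ ((2 : ℝ≥0∞).toReal⁻¹) with hD₂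
  refine ⟨D₂ * D₁, fun K C hK hC => ?_⟩
  have hC0 : 0 ≤ C := (norm_nonneg _).trans (hC 0)
  have hint : ∀ (f : L2 a b) (t : ℝ), Integrable (fun s => K (t, s) * f s) (leb a b) :=
    fun f t => (integrable_coeFn f).bdd_mul (c := C)
      (hK.comp measurable_prodMk_left).aestronglyMeasurable (Eventually.of_forall fun s => hC _)
  have hbd : ∀ (f : L2 a b) (t : ℝ), ‖∫ s, K (t, s) * f s ∂(leb a b)‖ ≤ C * D₁ * ‖f‖ := by
    intro f t
    calc _ ≤ ∫ s, C * ‖f s‖ ∂(leb a b) := by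
          refine norm_integral_le_of_norm_le ((integrable_coeFn f).norm.const_mul C)
            (Eventually.of_forall fun s => ?_)
          rw [norm_mul]
          gcongr
          exact hC _
      _ = C * ∫ s, ‖f s‖ ∂(leb a b) := integral_const_mul _ _
      _ ≤ C * (D₁ * ‖f‖) := by
          gcongr
          exact hD₁.2 f
      _ = _ := by ring
  have hmeas : ∀ f : L2 a b,
      AEStronglyMeasurable (fun t => ∫ s, K (t, s) * f s ∂(leb a b)) (leb a b) := fun f => by
    refine AEStronglyMeasurable.integral_prod_right' (f := fun p : ℝ × ℝ => K p * f p.2) ?_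
    exact hK.aestronglyMeasurable.mul (Lp.aestronglyMeasurable f).comp_snd
  have hmem : ∀ f : L2 a b, MemLp (fun t => ∫ s, K (t, s) * f s ∂(leb a b)) 2 (leb a b) :=
    fun f => MemLp.of_bound (hmeas f) _ (Eventually.of_forall (hbd f))
  let T : L2 a b →ₗ[ℂ] L2 a b :=
    { toFun := fun f => (hmem f).toLp
      map_add' := fun f g => by
        rw [← MemLp.toLp_add, MemLp.toLp_eq_toLp_iff]
        refine Eventually.of_forall fun t => ?_
        simp only [Pi.add_apply]
        rw [← integral_add (hint f t) (hint g t)]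
        refine integral_congr_ae ?_
        filter_upwards [Lp.coeFn_add f g] with s hs
        rw [hs, Pi.add_apply, mul_add]
      map_smul' := fun c f => by
        rw [RingHom.id_apply, ← MemLp.toLp_const_smul, MemLp.toLp_eq_toLp_iff]
        refine Eventually.of_forall fun t => ?_
        simp only [Pi.smul_apply, smul_eq_mul]
        rw [← integral_const_mul]
        refine integral_congr_ae ?_
        filter_upwards [Lp.coeFn_smul c f] with s hs
        rw [hs, Pi.smul_apply, smul_eq_mul, mul_left_comm] }
  have hT : ∀ f, T f =ᵐ[leb a b] fun t => ∫ s, K (t, s) * f s ∂(leb a b) := fun f =>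
    (hmem f).coeFn_toLp
  have hTn : ∀ f, ‖T f‖ ≤ C * (D₂ * D₁) * ‖f‖ := fun f => by
    have h := Lp.norm_le_of_ae_bound (f := T f) (C := C * D₁ * ‖f‖) (by have := hD₁.1; positivity)
      (by
        filter_upwards [hT f] with t ht
        rw [ht]
        exact hbd f t)
    refine h.trans (le_of_eq ?_)
    rw [hD₂]
    ring
  refine ⟨T.mkContinuous _ hTn, ?_, fun f => ?_⟩
  · refine T.mkContinuous_norm_le ?_ _
    have := hD₁.1
    positivity
  · refine (hT f).trans (Eventually.of_forall fun t => ?_)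
    simp only
    rw [intervalIntegral_eq_leb hab]

end KernelOperator

/-! ### The resolvent set and the boundary determinant -/

section Resolvent

open scoped BoundedContinuousFunction

variable {a b : ℝ} {q : ℝ → ℂ} {μ : ℂ} {φ₀ ψ₀ : ℝ →ᵇ ℂ} {φ₁ ψ₁ : ℝ → ℂ}
  {α β : Matrix (Fin 2) (Fin 2) ℂ}

theorem mem_graph_operator (hab : a < b) {p r : L2 a b} (h : (p, r) ∈ graph a b q α β) :
    ∃ hp : p ∈ (operator a b q α β).domain, operator a b q α β ⟨p, hp⟩ = r := by
  rw [← graph_operator hab, LinearPMap.mem_graph_iff] at h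
  obtain ⟨⟨y, hy⟩, h1, h2⟩ := h
  simp only at h1 h2
  subst h1
  exact ⟨hy, h2⟩

theorem operator_mem_graph (hab : a < b) (y : (operator a b q α β).domain) :
    ((y : L2 a b), operator a b q α β y) ∈ graph a b q α β := by
  rw [← graph_operator hab]
  exact LinearPMap.mem_graph _ y

/-- Solvability of the boundary problem makes the integral operator a right inverse of `L - μ`;
since every solution is given by the kernel, it is also a left inverse. -/
theorem IsFundamentalSystem.isGreenFunction (hab : a < b) (hq : MemLp q 2 (leb a b))
    (h : IsFundamentalSystem a b q μ φ₀ φ₁ ψ₀ ψ₁)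
    (hdet : (boundaryMatrix α β (fundamentalMatrix φ₀ φ₁ ψ₀ ψ₁ b)).det ≠ 0) :
    IsGreenFunction a b (operator a b q α β) μ
      (greenKernel φ₀ ψ₀ (correctionMatrix α β (fundamentalMatrix φ₀ φ₁ ψ₀ ψ₁ b))) := by
  set N := correctionMatrix α β (fundamentalMatrix φ₀ φ₁ ψ₀ ψ₁ b)
  have hm := measurable_greenKernel φ₀ ψ₀ N
  have hb := norm_greenKernel_le φ₀ ψ₀ N
  obtain ⟨D, hD⟩ := exists_kernel_operator hab.le
  obtain ⟨R, -, hR⟩ := hD _ _ hm hb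
  have hres : IsResolventAt (operator a b q α β) μ R := by
    constructor
    · intro f
      have hf := intervalIntegrable_of_integrable_leb hab.le (integrable_coeFn f)
      obtain ⟨y, u, hs, hbc⟩ := h.exists_solution hab.le hdet hf
      have hRy : R f =ᵐ[leb a b] y := by
        filter_upwards [hR f, ae_restrict_mem measurableSet_Icc] with t h1 h2
        rw [h1, h.eq_integral_greenKernel hab.le hdet hf hs hbc h2]
      have hg : (R f, μ • R f + f) ∈ graph a b q α β := by
        refine ⟨y, u, _, hs.hasQuasiDerivs hab.le, hbc, hRy, ?_⟩
        filter_upwards [Lp.coeFn_add (μ • R f) f, Lp.coeFn_smul μ (R f), hRy] with t h1 h2 h3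
        rw [h1, Pi.add_apply, h2, Pi.smul_apply, h3, smul_eq_mul]
      obtain ⟨hp, he⟩ := mem_graph_operator hab hg
      exact ⟨hp, by rw [he, add_sub_cancel_left]⟩
    · intro y
      obtain ⟨z, u, g, hz, hbc, h1, h2⟩ := operator_mem_graph hab y
      simp only at h1 h2
      set f := operator a b q α β y - μ • (y : L2 a b) with hfdef
      have hf := intervalIntegrable_of_integrable_leb hab.le (integrable_coeFn f)
      have hg : IntervalIntegrable g volume a b := intervalIntegrable_of_integrable_leb hab.le
        ((integrable_coeFn (operator a b q α β y)).congr h2)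
      have hfg : f =ᵐ[leb a b] fun t => g t - μ * z t := by
        filter_upwards [Lp.coeFn_sub (operator a b q α β y) (μ • (y : L2 a b)),
          Lp.coeFn_smul μ (y : L2 a b), h1, h2] with t e1 e2 e3 e4
        rw [hfdef, e1, Pi.sub_apply, e2, Pi.smul_apply, e3, e4, smul_eq_mul]
      have hs := hz.solvesSystem hab.le hq μ hg hfg
      refine Lp.ext ?_
      filter_upwards [hR f, h1, ae_restrict_mem measurableSet_Icc] with t e1 e2 e3
      rw [e1, e2, h.eq_integral_greenKernel hab.le hdet hf hs hbc e3]
  refine ⟨⟨R, hres⟩, ?_, fun f => ?_⟩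
  · exact memLp_top_of_bound hm.aestronglyMeasurable _ (Eventually.of_forall hb)
  · rw [← hres.eq_resolvent]
    exact hR f

/-- The boundary matrix is invertible if `μ` is in the resolvent set. -/
theorem IsFundamentalSystem.det_ne_zero (hab : a < b)
    (h : IsFundamentalSystem a b q μ φ₀ φ₁ ψ₀ ψ₁)
    (hμ : μ ∈ resolventSet (operator a b q α β)) :
    (boundaryMatrix α β (fundamentalMatrix φ₀ φ₁ ψ₀ ψ₁ b)).det ≠ 0 := by
  intro hdet
  obtain ⟨c, hc, hMc⟩ := Matrix.exists_mulVec_eq_zero_iff.2 hdet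
  obtain ⟨R, -, hR⟩ := hμ
  -- The homogeneous solution with initial values `c`, a null vector of the boundary matrix, written
  -- as variation of constants with source 0. It lies in the kernel of `L - μ`.
  set y : ℝ → ℂ := fun t => φ₀ t * (c 0 + ∫ s in a..t, (0 : ℝ → ℂ) s * ψ₀ s)
    + ψ₀ t * (c 1 - ∫ s in a..t, (0 : ℝ → ℂ) s * φ₀ s) with hy
  set u : ℝ → ℂ := fun t => φ₁ t * (c 0 + ∫ s in a..t, (0 : ℝ → ℂ) s * ψ₀ s)
    + ψ₁ t * (c 1 - ∫ s in a..t, (0 : ℝ → ℂ) s * φ₀ s) with hu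
  have hs : SolvesSystem a b q μ 0 y u :=
    h.solvesSystem hab.le (f := 0) intervalIntegrable_const (c 0) (c 1)
  have hya : y a = c 0 := by simp [hy, h.left_zero, h.right_zero]
  have hua : u a = c 1 := by simp [hu, h.left_one, h.right_one]
  have hca : ![y a, u a] = c := by
    ext i
    fin_cases i <;> simp [hya, hua]
  have hbc : BoundaryCondition a b α β y u := by
    unfold BoundaryCondition
    rw [h.boundary_eq hab.le α β hs, hca, hMc, zero_add]
    have : ![∫ s in a..b, (0 : ℝ → ℂ) s * ψ₀ s, -∫ s in a..b, (0 : ℝ → ℂ) s * φ₀ s] = 0 := by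
      ext i
      fin_cases i <;> simp
    rw [this, Matrix.mulVec_zero]
  have hcy := hs.fst.continuousOn hab.le
  obtain ⟨C, hC⟩ := isCompact_Icc.exists_bound_of_continuousOn hcy
  have hmem : MemLp y 2 (leb a b) := MemLp.of_bound (hcy.aestronglyMeasurable measurableSet_Icc) C
    ((ae_restrict_iff' measurableSet_Icc).2 (Eventually.of_forall hC))
  have hqd := hs.hasQuasiDerivs hab.le
  have hg : (hmem.toLp, μ • hmem.toLp) ∈ graph a b q α β := by
    refine ⟨y, u, _, hqd, hbc, hmem.coeFn_toLp, ?_⟩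
    filter_upwards [Lp.coeFn_smul μ hmem.toLp, hmem.coeFn_toLp] with t e1 e2
    rw [e1, Pi.smul_apply, e2]
    simp
  obtain ⟨hp, he⟩ := mem_graph_operator hab hg
  have h0 := hR ⟨_, hp⟩
  rw [he, sub_self, map_zero] at h0
  have hy0 : y =ᵐ[leb a b] 0 := by
    refine hmem.coeFn_toLp.symm.trans ?_
    rw [← show (0 : L2 a b) = hmem.toLp from h0]
    exact Lp.coeFn_zero _ _ _
  have hu0 : u =ᵐ[leb a b] 0 := by
    filter_upwards [hqd.deriv_one, ae_deriv_eq_zero hab hqd.ac_zero hy0, hy0] with t e1 e2 e3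
    simp [e1, e2, e3]
  have ha : a ∈ Icc a b := left_mem_Icc.2 hab.le
  -- By continuity `y` and `u` vanish at `a` itself, so `c = 0`, a contradiction.
  have z1 := Measure.eqOn_Icc_of_ae_eq volume hab.ne hy0 hcy continuousOn_const ha
  have z2 := Measure.eqOn_Icc_of_ae_eq volume hab.ne hu0 (hs.snd.continuousOn hab.le)
    continuousOn_const ha
  refine hc ?_
  rw [← hca, z1, z2]
  ext i
  fin_cases i <;> rfl

end Resolvent

/-! ### Uniform convergence of the fundamental systems -/

section SystemSolution

open scoped BoundedContinuousFunction

/-- The coefficient of `q` in the matrix of the first order system. -/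
noncomputable def linearPart : ℂ × ℂ →L[ℝ] ℂ × ℂ :=
  (ContinuousLinearMap.fst ℝ ℂ ℂ).prod (-(ContinuousLinearMap.snd ℝ ℂ ℂ))

/-- The coefficient of `q ^ 2` in the matrix of the first order system. -/
noncomputable def quadraticPart : ℂ × ℂ →L[ℝ] ℂ × ℂ :=
  (0 : ℂ × ℂ →L[ℝ] ℂ).prod (-(ContinuousLinearMap.fst ℝ ℂ ℂ))

/-- The constant part of the matrix of the first order system. -/
noncomputable def constantPart (μ : ℂ) : ℂ × ℂ →L[ℝ] ℂ × ℂ :=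
  (ContinuousLinearMap.snd ℝ ℂ ℂ).prod (-(μ • ContinuousLinearMap.fst ℝ ℂ ℂ))

/-- The matrix of the first order system as a linear map. -/
noncomputable def systemMap (q : ℝ → ℂ) (μ : ℂ) (t : ℝ) : ℂ × ℂ →L[ℝ] ℂ × ℂ :=
  q t • linearPart + q t ^ 2 • quadraticPart + constantPart μ

theorem systemMap_apply (q : ℝ → ℂ) (μ : ℂ) (t : ℝ) (v : ℂ × ℂ) :
    systemMap q μ t v = (q t * v.1 + v.2, -(q t * v.2) - q t ^ 2 * v.1 - μ * v.1) := by
  simp only [systemMap, linearPart, quadraticPart, constantPart]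
  ext
  · simp
  · simp
    ring

/-- An integrable weight which dominates the coefficients of the system. -/
noncomputable def systemWeight (q : ℝ → ℂ) (μ : ℂ) (t : ℝ) : ℝ :=
  (‖linearPart‖ + ‖quadraticPart‖ + ‖constantPart μ‖) * (1 + ‖q t‖ ^ 2)

theorem norm_systemMap_le (q : ℝ → ℂ) (μ : ℂ) (t : ℝ) :
    ‖systemMap q μ t‖ ≤ systemWeight q μ t := by
  have h : ‖systemMap q μ t‖ ≤ ‖q t‖ * ‖linearPart‖ + ‖q t‖ ^ 2 * ‖quadraticPart‖
      + ‖constantPart μ‖ := by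
    refine (norm_add_le _ _).trans (add_le_add ((norm_add_le _ _).trans ?_) le_rfl)
    rw [norm_smul, norm_smul, norm_pow]
  refine h.trans ?_
  unfold systemWeight
  -- Bounding `‖q‖` by `1 + ‖q‖ ^ 2` lets the integral of the weight be controlled by the `L_2` norm
  -- of `q` alone.
  have h1 : ‖q t‖ ≤ 1 + ‖q t‖ ^ 2 := by nlinarith [sq_nonneg (‖q t‖ - 1), norm_nonneg (q t)]
  have h2 : ‖q t‖ ^ 2 ≤ 1 + ‖q t‖ ^ 2 := by linarith
  have h3 : 1 ≤ 1 + ‖q t‖ ^ 2 := by nlinarith [sq_nonneg ‖q t‖]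
  have n1 := norm_nonneg linearPart
  have n2 := norm_nonneg quadraticPart
  have n3 := norm_nonneg (constantPart μ)
  nlinarith [mul_le_mul_of_nonneg_right h1 n1, mul_le_mul_of_nonneg_right h2 n2,
    mul_le_mul_of_nonneg_right h3 n3]

theorem intervalIntegrable_systemMap {a b : ℝ} (hab : a ≤ b) {q : ℝ → ℂ}
    (hq : MemLp q 2 (leb a b)) (μ : ℂ) : IntervalIntegrable (systemMap q μ) volume a b := by
  have h1 := intervalIntegrable_of_memLp hab hq
  have h2 := intervalIntegrable_sq_of_memLp hab hq
  exact ((h1.smul_continuousOn continuousOn_const).add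
    (h2.smul_continuousOn continuousOn_const)).add intervalIntegrable_const

theorem intervalIntegrable_systemWeight {a b : ℝ} (hab : a ≤ b) {q : ℝ → ℂ}
    (hq : MemLp q 2 (leb a b)) (μ : ℂ) : IntervalIntegrable (systemWeight q μ) volume a b := by
  have h2 := (intervalIntegrable_sq_of_memLp hab hq).norm
  simp only [norm_pow] at h2
  exact (intervalIntegrable_const.add h2).const_mul _

theorem integral_norm_sq_eq {a b : ℝ} (hab : a ≤ b) {q : ℝ → ℂ} (hq : MemLp q 2 (leb a b)) :
    ∫ t in a..b, ‖q t‖ ^ 2 = (eLpNorm q 2 (leb a b)).toReal ^ 2 := by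
  have h0 : 0 ≤ ∫ t, ‖q t‖ ^ 2 ∂(leb a b) := integral_nonneg fun t => by positivity
  rw [intervalIntegral.integral_of_le hab, ← integral_Icc_eq_integral_Ioc,
    hq.eLpNorm_eq_integral_rpow_norm (by norm_num) (by norm_num)]
  simp only [ENNReal.toReal_ofNat, Real.rpow_two]
  rw [ENNReal.toReal_ofReal (Real.rpow_nonneg h0 _), ← Real.rpow_natCast, ← Real.rpow_mul h0]
  norm_num

theorem integral_systemWeight_le {a b C : ℝ} (hab : a ≤ b) {q : ℝ → ℂ}
    (hq : MemLp q 2 (leb a b)) (μ : ℂ) (hC : (eLpNorm q 2 (leb a b)).toReal ≤ C) :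
    ∫ t in a..b, systemWeight q μ t ≤
      (‖linearPart‖ + ‖quadraticPart‖ + ‖constantPart μ‖) * ((b - a) + C ^ 2) := by
  have h2 := (intervalIntegrable_sq_of_memLp hab hq).norm
  simp only [norm_pow] at h2
  unfold systemWeight
  rw [intervalIntegral.integral_const_mul,
    intervalIntegral.integral_add intervalIntegrable_const h2, integral_norm_sq_eq hab hq]
  simp only [intervalIntegral.integral_const, smul_eq_mul, mul_one]
  have := ENNReal.toReal_nonneg (a := eLpNorm q 2 (leb a b))
  gcongr

/-- `Y` solves the homogeneous system with the initial value `c` on `[a, b]`, and is extended by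
constants. -/
structure IsSystemSolution (a b : ℝ) (hab : a ≤ b) (q : ℝ → ℂ) (μ : ℂ) (c : ℂ × ℂ)
    (Y : ℝ →ᵇ ℂ × ℂ) : Prop where
  extension : ∀ t, Y t = Y (projIcc a b hab t)
  eq : ∀ t ∈ Icc a b, Y t = c + ∫ s in a..t, systemMap q μ s (Y s)

theorem exists_isSystemSolution {a b : ℝ} (hab : a ≤ b) {q : ℝ → ℂ} (hq : MemLp q 2 (leb a b))
    (μ : ℂ) (c : ℂ × ℂ) : ∃ Y, IsSystemSolution a b hab q μ c Y := by
  obtain ⟨Y, h1, h2⟩ := exists_linear_solution hab (intervalIntegrable_systemMap hab hq μ) c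
  exact ⟨Y, h1, h2⟩

variable {a b : ℝ} {hab : a ≤ b} {q : ℝ → ℂ} {μ : ℂ} {c : ℂ × ℂ} {Y : ℝ →ᵇ ℂ × ℂ}

theorem IsSystemSolution.initial (h : IsSystemSolution a b hab q μ c Y) : Y a = c := by
  rw [h.eq a (left_mem_Icc.2 hab)]
  simp

theorem IsSystemSolution.isPrimitive (h : IsSystemSolution a b hab q μ c Y)
    (hq : MemLp q 2 (leb a b)) : IsPrimitive a b Y (fun t => systemMap q μ t (Y t)) :=
  ⟨intervalIntegrable_clm_apply hab (intervalIntegrable_systemMap hab hq μ)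
    Y.continuous.continuousOn, fun t ht => by rw [h.initial, h.eq t ht]⟩

theorem IsSystemSolution.solvesSystem (h : IsSystemSolution a b hab q μ c Y)
    (hq : MemLp q 2 (leb a b)) :
    SolvesSystem a b q μ 0 (fun t => (Y t).1) (fun t => (Y t).2) := by
  have hp := h.isPrimitive hq
  constructor
  · have := hp.comp_clm hab (ContinuousLinearMap.fst ℝ ℂ ℂ)
    simpa [systemMap_apply] using this
  · have := hp.comp_clm hab (ContinuousLinearMap.snd ℝ ℂ ℂ)
    simpa [systemMap_apply] using this

/-- The first component of a bounded continuous function. -/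
noncomputable def firstComponent : (ℝ →ᵇ ℂ × ℂ) →L[ℝ] (ℝ →ᵇ ℂ) :=
  (ContinuousLinearMap.fst ℝ ℂ ℂ).compLeftContinuousBounded ℝ

theorem firstComponent_apply (Y : ℝ →ᵇ ℂ × ℂ) (t : ℝ) : firstComponent Y t = (Y t).1 := rfl

/-- Only the first components enter the Green kernel, so only they need to be bounded continuous
functions; the second ones matter through their values at `b`. -/
theorem isFundamentalSystem_of_isSystemSolution {Z : ℝ →ᵇ ℂ × ℂ}
    (hY : IsSystemSolution a b hab q μ (1, 0) Y) (hZ : IsSystemSolution a b hab q μ (0, 1) Z)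
    (hq : MemLp q 2 (leb a b)) :
    IsFundamentalSystem a b q μ (firstComponent Y) (fun t => (Y t).2) (firstComponent Z)
      (fun t => (Z t).2) := by
  refine ⟨hY.solvesSystem hq, hZ.solvesSystem hq, ?_, ?_, ?_, ?_⟩
  · rw [firstComponent_apply, hY.initial]
  · simp only [hY.initial]
  · rw [firstComponent_apply, hZ.initial]
  · simp only [hZ.initial]

/-- The part containing `μ` cancels, leaving exactly the two differences whose primitives are
assumed to be small. -/
theorem systemMap_sub_apply (q p : ℝ → ℂ) (μ : ℂ) (t : ℝ) (v : ℂ × ℂ) :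
    (systemMap q μ t - systemMap p μ t) v =
      (q t - p t) • linearPart v + (q t ^ 2 - p t ^ 2) • quadraticPart v := by
  simp only [systemMap, sub_apply, add_apply, smul_apply, sub_smul]
  abel

/-- The solutions of the systems converge uniformly. -/
theorem tendsto_isSystemSolution {q : ℝ → ℝ → ℂ} {Y : ℝ → ℝ →ᵇ ℂ × ℂ}
    (hq₀ : MemLp (q 0) 2 (leb a b)) (hY₀ : IsSystemSolution a b hab (q 0) μ c (Y 0))
    (hY : ∀ᶠ ε in 𝓝[>] (0 : ℝ),
      MemLp (q ε) 2 (leb a b) ∧ IsSystemSolution a b hab (q ε) μ c (Y ε))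
    (h1 : (fun ε => (eLpNorm (q ε) 2 (leb a b)).toReal) =O[𝓝[>] (0 : ℝ)] (fun _ => (1 : ℝ)))
    (h2 : TendstoUniformlyOn (fun ε t => ∫ x in a..t, (q ε x - q 0 x)) (fun _ => 0)
      (𝓝[>] (0 : ℝ)) (Icc a b))
    (h3 : TendstoUniformlyOn (fun ε t => ∫ x in a..t, (q ε x ^ 2 - q 0 x ^ 2)) (fun _ => 0)
      (𝓝[>] (0 : ℝ)) (Icc a b)) :
    Tendsto Y (𝓝[>] (0 : ℝ)) (𝓝 (Y 0)) := by
  obtain ⟨C, hC⟩ := h1.bound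
  have hp := hY₀.isPrimitive hq₀
  have p1 := hp.comp_clm hab linearPart
  have p2 := hp.comp_clm hab quadraticPart
  set I₁ := ∫ s in a..b, ‖linearPart (systemMap (q 0) μ s (Y 0 s))‖
  set I₂ := ∫ s in a..b, ‖quadraticPart (systemMap (q 0) μ s (Y 0 s))‖
  have hI₁ : 0 ≤ I₁ := intervalIntegral.integral_nonneg hab fun s _ => norm_nonneg _
  have hI₂ : 0 ≤ I₂ := intervalIntegral.integral_nonneg hab fun s _ => norm_nonneg _
  -- `S` collects the sup norm and derivative terms from integration by parts, and `κ` bounds the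
  -- Gronwall weight. Neither depends on `ε`.
  set S := (‖linearPart‖ * ‖Y 0‖ + I₁) + (‖quadraticPart‖ * ‖Y 0‖ + I₂) with hS
  set κ := (‖linearPart‖ + ‖quadraticPart‖ + ‖constantPart μ‖) * ((b - a) + C ^ 2)
  have hS0 : 0 ≤ S := by positivity
  set L := 2 * S * Real.exp (2 * κ) with hL
  have hL0 : 0 ≤ L := by positivity
  have key : ∀ η > 0, ∀ᶠ ε in 𝓝[>] (0 : ℝ), ‖Y ε - Y 0‖ ≤ η * L := by
    intro η hη
    have u2 := Metric.tendstoUniformlyOn_iff.1 h2 η hη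
    have u3 := Metric.tendstoUniformlyOn_iff.1 h3 η hη
    filter_upwards [hY, hC, u2, u3] with ε ⟨hqε, hYε⟩ hCε u2 u3
    refine (BoundedContinuousFunction.norm_le (by positivity)).2 fun t => ?_
    rw [BoundedContinuousFunction.sub_apply, hYε.extension t, hY₀.extension t]
    have hτ := (projIcc a b hab t).2
    have hA := intervalIntegrable_systemMap hab hqε μ
    have hA₀ := intervalIntegrable_systemMap hab hq₀ μ
    have i1 := (intervalIntegrable_of_memLp hab hqε).sub (intervalIntegrable_of_memLp hab hq₀)
    have i2 := (intervalIntegrable_sq_of_memLp hab hqε).sub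
      (intervalIntegrable_sq_of_memLp hab hq₀)
    have ha : a ∈ Icc a b := left_mem_Icc.2 hab
    have hδ : ∀ t ∈ Icc a b,
        ‖∫ s in a..t, (systemMap (q ε) μ s - systemMap (q 0) μ s) (Y 0 s)‖ ≤ η * S := by
      intro t ht
      have c1 := p1.continuousOn hab
      have c2 := p2.continuousOn hab
      rw [← uIcc_of_le hab] at c1 c2
      simp_rw [systemMap_sub_apply]
      rw [intervalIntegral.integral_add
        (intervalIntegrable_mono_Icc (i1.smul_continuousOn c1) ha ht)
        (intervalIntegrable_mono_Icc (i2.smul_continuousOn c2) ha ht)]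
      have b1 := norm_integral_smul_le hab i1 p1 (δ := η)
        (fun t ht => by simpa using (u2 t ht).le) ht
      have b2 := norm_integral_smul_le hab i2 p2 (δ := η)
        (fun t ht => by simpa using (u3 t ht).le) ht
      have n1 := linearPart.le_opNorm_of_le ((Y 0).norm_coe_le_norm t)
      have n2 := quadraticPart.le_opNorm_of_le ((Y 0).norm_coe_le_norm t)
      rw [hS, mul_add]
      refine (norm_add_le _ _).trans (add_le_add (b1.trans ?_) (b2.trans ?_)) <;> gcongr
    have hCε' : (eLpNorm (q ε) 2 (leb a b)).toReal ≤ C := by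
      simpa [abs_of_nonneg ENNReal.toReal_nonneg] using hCε
    calc _ ≤ 2 * (η * S) * Real.exp (2 * ∫ s in a..b, systemWeight (q ε) μ s) :=
          norm_linear_solution_sub_le hab hA hA₀ (intervalIntegrable_systemWeight hab hqε μ)
            (norm_systemMap_le _ _) (Y ε).continuous.continuousOn (Y 0).continuous.continuousOn
            hYε.eq hY₀.eq hδ hτ
      _ ≤ 2 * (η * S) * Real.exp (2 * κ) := by
          gcongr
          exact integral_systemWeight_le hab hqε μ hCε'
      _ = η * L := by rw [hL]; ring
  rw [Metric.tendsto_nhds]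
  intro e he
  -- Dividing by `L + 1` covers the case `L = 0` and gives a strict inequality.
  filter_upwards [key (e / (L + 1)) (by positivity)] with ε hε
  rw [dist_eq_norm]
  refine hε.trans_lt ?_
  rw [div_mul_eq_mul_div, div_lt_iff₀ (by positivity)]
  nlinarith

end SystemSolution

/-! ### Convergence of the Green functions and of the resolvents -/

section Convergence

open scoped BoundedContinuousFunction

/-- The difference of the resolvents is the integral operator of the difference of the kernels. `D`
precedes the operators in the quantifiers, so it is uniform in `ε`. -/
theorem norm_resolvent_sub_le {a b : ℝ} (hab : a ≤ b) (μ : ℂ) : ∃ D : ℝ,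
    ∀ (T T' : L2 a b →ₗ.[ℂ] L2 a b) (φ ψ φ' ψ' : ℝ →ᵇ ℂ) (N N' : Matrix (Fin 2) (Fin 2) ℂ),
      IsGreenFunction a b T μ (greenKernel φ ψ N) →
      IsGreenFunction a b T' μ (greenKernel φ' ψ' N') →
      ‖resolvent T μ - resolvent T' μ‖ ≤
        (‖causalPart φ ψ - causalPart φ' ψ'‖ + ‖smoothPart φ ψ N - smoothPart φ' ψ' N'‖) * D := by
  obtain ⟨D, hD⟩ := exists_kernel_operator hab
  refine ⟨D, fun T T' φ ψ φ' ψ' N N' hT hT' => ?_⟩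
  have m := measurable_greenKernel φ ψ N
  have m' := measurable_greenKernel φ' ψ' N'
  obtain ⟨R, hRn, hR⟩ := hD _ _ (m.sub m') (norm_greenKernel_sub_le φ ψ φ' ψ' N N')
  have hi : ∀ (φ ψ : ℝ →ᵇ ℂ) (N : Matrix (Fin 2) (Fin 2) ℂ) (f : L2 a b) (t : ℝ),
      IntervalIntegrable (fun s => greenKernel φ ψ N (t, s) * f s) volume a b := by
    intro φ ψ N f t
    refine intervalIntegrable_of_integrable_leb hab ?_
    exact (integrable_coeFn f).bdd_mul
      ((measurable_greenKernel φ ψ N).comp measurable_prodMk_left).aestronglyMeasurable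
      (Eventually.of_forall fun s => norm_greenKernel_le φ ψ N _)
  have he : resolvent T μ - resolvent T' μ = R := by
    refine ContinuousLinearMap.ext fun f => Lp.ext ?_
    filter_upwards [Lp.coeFn_sub (resolvent T μ f) (resolvent T' μ f), hT.2.2 f, hT'.2.2 f, hR f]
      with t e1 e2 e3 e4
    rw [sub_apply, e1, Pi.sub_apply, e2, e3, e4,
      ← intervalIntegral.integral_sub (hi φ ψ N f t) (hi φ' ψ' N' f t)]
    refine intervalIntegral.integral_congr fun s _ => ?_
    simp only [Pi.sub_apply]
    ring
  rwa [he]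

theorem tendsto_matrix_inv {ι : Type*} {l : Filter ι} {M : ι → Matrix (Fin 2) (Fin 2) ℂ}
    {M₀ : Matrix (Fin 2) (Fin 2) ℂ} (h : Tendsto M l (𝓝 M₀)) (hdet : M₀.det ≠ 0) :
    Tendsto (fun i => (M i)⁻¹) l (𝓝 M₀⁻¹) := by
  simp only [Matrix.inv_def, Ring.inverse_eq_inv']
  exact (((continuous_id.matrix_det.tendsto M₀).comp h).inv₀ hdet).smul
    ((continuous_id.matrix_adjugate.tendsto M₀).comp h)

theorem tendsto_tensor {ι : Type*} {l : Filter ι} {x y : ι → ℝ →ᵇ ℂ} {x₀ y₀ : ℝ →ᵇ ℂ}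
    (hx : Tendsto x l (𝓝 x₀)) (hy : Tendsto y l (𝓝 y₀)) :
    Tendsto (fun i => tensor (x i) (y i)) l (𝓝 (tensor x₀ y₀)) :=
  (((BoundedContinuousFunction.continuous_compContinuous
      (⟨Prod.fst, continuous_fst⟩ : C(ℝ × ℝ, ℝ))).tendsto x₀).comp hx).mul
    (((BoundedContinuousFunction.continuous_compContinuous
      (⟨Prod.snd, continuous_snd⟩ : C(ℝ × ℝ, ℝ))).tendsto y₀).comp hy)

theorem tendsto_causalPart {ι : Type*} {l : Filter ι} {x y : ι → ℝ →ᵇ ℂ} {x₀ y₀ : ℝ →ᵇ ℂ}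
    (hx : Tendsto x l (𝓝 x₀)) (hy : Tendsto y l (𝓝 y₀)) :
    Tendsto (fun i => causalPart (x i) (y i)) l (𝓝 (causalPart x₀ y₀)) :=
  (tendsto_tensor hx hy).sub (tendsto_tensor hy hx)

theorem tendsto_smoothPart {ι : Type*} {l : Filter ι} {x y : ι → ℝ →ᵇ ℂ} {x₀ y₀ : ℝ →ᵇ ℂ}
    {N : ι → Matrix (Fin 2) (Fin 2) ℂ} {N₀ : Matrix (Fin 2) (Fin 2) ℂ}
    (hx : Tendsto x l (𝓝 x₀)) (hy : Tendsto y l (𝓝 y₀)) (hN : Tendsto N l (𝓝 N₀)) :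
    Tendsto (fun i => smoothPart (x i) (y i) (N i)) l (𝓝 (smoothPart x₀ y₀ N₀)) := by
  have e : ∀ i j, Tendsto (fun k => N k i j) l (𝓝 (N₀ i j)) := fun i j =>
    tendsto_pi_nhds.1 (tendsto_pi_nhds.1 hN i) j
  exact (tendsto_tensor (((e 0 0).smul hx).add ((e 1 0).smul hy)) hy).sub
    (tendsto_tensor (((e 0 1).smul hx).add ((e 1 1).smul hy)) hx)

/-- Invertibility of the boundary matrix at `ε = 0` comes from `μ ∈ ρ(L_0)` and persists for small
`ε` by continuity of the determinant. -/
theorem exists_green_convergence {a b : ℝ} (hab : a < b) {ε₀ : ℝ} (hε₀ : 0 < ε₀)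
    {q : ℝ → ℝ → ℂ} {α β : ℝ → Matrix (Fin 2) (Fin 2) ℂ}
    (hq : ∀ ε ∈ Icc 0 ε₀, MemLp (q ε) 2 (leb a b))
    (h1 : (fun ε => (eLpNorm (q ε) 2 (leb a b)).toReal) =O[𝓝[>] (0 : ℝ)] (fun _ => (1 : ℝ)))
    (h2 : TendstoUniformlyOn (fun ε t => ∫ x in a..t, (q ε x - q 0 x)) (fun _ => 0)
      (𝓝[>] (0 : ℝ)) (Icc a b))
    (h3 : TendstoUniformlyOn (fun ε t => ∫ x in a..t, (q ε x ^ 2 - q 0 x ^ 2)) (fun _ => 0)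
      (𝓝[>] (0 : ℝ)) (Icc a b))
    (hα : Tendsto α (𝓝[>] (0 : ℝ)) (𝓝 (α 0))) (hβ : Tendsto β (𝓝[>] (0 : ℝ)) (𝓝 (β 0)))
    {μ : ℂ} (hμ : μ ∈ resolventSet (operator a b (q 0) (α 0) (β 0))) :
    ∃ (φ ψ : ℝ → ℝ →ᵇ ℂ) (N : ℝ → Matrix (Fin 2) (Fin 2) ℂ),
      IsGreenFunction a b (operator a b (q 0) (α 0) (β 0)) μ
        (greenKernel (φ 0) (ψ 0) (N 0)) ∧
      (∀ᶠ ε in 𝓝[>] (0 : ℝ), IsGreenFunction a b (operator a b (q ε) (α ε) (β ε)) μ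
        (greenKernel (φ ε) (ψ ε) (N ε))) ∧
      Tendsto (fun ε => ‖causalPart (φ ε) (ψ ε) - causalPart (φ 0) (ψ 0)‖
        + ‖smoothPart (φ ε) (ψ ε) (N ε) - smoothPart (φ 0) (ψ 0) (N 0)‖)
        (𝓝[>] (0 : ℝ)) (𝓝 0) := by
  -- The implication inside the existential allows a choice for every real `ε`, with the value 0
  -- outside `[0, ε₀]`.
  have hex : ∀ c : ℂ × ℂ, ∀ ε, ∃ Y, ε ∈ Icc 0 ε₀ → IsSystemSolution a b hab.le (q ε) μ c Y := by
    intro c ε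
    by_cases hε : ε ∈ Icc 0 ε₀
    · obtain ⟨Y, hY⟩ := exists_isSystemSolution hab.le (hq ε hε) μ c
      exact ⟨Y, fun _ => hY⟩
    · exact ⟨0, fun h => absurd h hε⟩
  choose Y hY using hex (1, 0)
  choose Z hZ using hex (0, 1)
  have h0 : (0 : ℝ) ∈ Icc 0 ε₀ := left_mem_Icc.2 hε₀.le
  have hev : ∀ᶠ ε in 𝓝[>] (0 : ℝ), ε ∈ Icc 0 ε₀ := by
    filter_upwards [Ioc_mem_nhdsGT hε₀] with ε hε using ⟨hε.1.le, hε.2⟩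
  have tY : Tendsto Y (𝓝[>] (0 : ℝ)) (𝓝 (Y 0)) :=
    tendsto_isSystemSolution (hq 0 h0) (hY 0 h0) (hev.mono fun ε hε => ⟨hq ε hε, hY ε hε⟩) h1 h2 h3
  have tZ : Tendsto Z (𝓝[>] (0 : ℝ)) (𝓝 (Z 0)) :=
    tendsto_isSystemSolution (hq 0 h0) (hZ 0 h0) (hev.mono fun ε hε => ⟨hq ε hε, hZ ε hε⟩) h1 h2 h3
  have tφ := (firstComponent.continuous.tendsto (Y 0)).comp tY
  have tψ := (firstComponent.continuous.tendsto (Z 0)).comp tZ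
  set F : ℝ → Matrix (Fin 2) (Fin 2) ℂ := fun ε => fundamentalMatrix (firstComponent (Y ε))
    (fun t => (Y ε t).2) (firstComponent (Z ε)) (fun t => (Z ε t).2) b with hF
  have tYb := ((BoundedContinuousFunction.lipschitz_eval_const (β := ℂ × ℂ) b).continuous.tendsto
    (Y 0)).comp tY
  have tZb := ((BoundedContinuousFunction.lipschitz_eval_const (β := ℂ × ℂ) b).continuous.tendsto
    (Z 0)).comp tZ
  have tF : Tendsto F (𝓝[>] (0 : ℝ)) (𝓝 (F 0)) := by
    refine tendsto_pi_nhds.2 fun i => tendsto_pi_nhds.2 fun j => ?_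
    fin_cases i <;> fin_cases j
    · exact (continuous_fst.tendsto _).comp tYb
    · exact (continuous_fst.tendsto _).comp tZb
    · exact (continuous_snd.tendsto _).comp tYb
    · exact (continuous_snd.tendsto _).comp tZb
  have tM : Tendsto (fun ε => boundaryMatrix (α ε) (β ε) (F ε)) (𝓝[>] (0 : ℝ))
      (𝓝 (boundaryMatrix (α 0) (β 0) (F 0))) := hα.add (hβ.mul tF)
  have hfund : ∀ ε ∈ Icc 0 ε₀, _ := fun ε hε =>
    isFundamentalSystem_of_isSystemSolution (hY ε hε) (hZ ε hε) (hq ε hε)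
  have hdet : (boundaryMatrix (α 0) (β 0) (F 0)).det ≠ 0 := (hfund 0 h0).det_ne_zero hab hμ
  have tN : Tendsto (fun ε => correctionMatrix (α ε) (β ε) (F ε)) (𝓝[>] (0 : ℝ))
      (𝓝 (correctionMatrix (α 0) (β 0) (F 0))) :=
    ((tendsto_matrix_inv tM hdet).mul (hβ.mul tF)).neg
  have hdetε : ∀ᶠ ε in 𝓝[>] (0 : ℝ), (boundaryMatrix (α ε) (β ε) (F ε)).det ≠ 0 :=
    ((continuous_id.matrix_det.tendsto _).comp tM).eventually_ne hdet
  refine ⟨fun ε => firstComponent (Y ε), fun ε => firstComponent (Z ε),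
    fun ε => correctionMatrix (α ε) (β ε) (F ε),
    (hfund 0 h0).isGreenFunction hab (hq 0 h0) hdet, ?_, ?_⟩
  · filter_upwards [hev, hdetε] with ε hε hd
    exact (hfund ε hε).isGreenFunction hab (hq ε hε) hd
  · have c1 := tendsto_iff_norm_sub_tendsto_zero.1 (tendsto_causalPart tφ tψ)
    have c2 := tendsto_iff_norm_sub_tendsto_zero.1 (tendsto_smoothPart tφ tψ tN)
    simpa using c1.add c2

end Convergence

end SturmLiouville

/-! ### The main theorem -/

theorem theorem2 (a b : ℝ) (hab : a < b) (ε₀ : ℝ) (hε₀ : 0 < ε₀)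
    (q : ℝ → ℝ → ℂ) (α β : ℝ → Matrix (Fin 2) (Fin 2) ℂ)
    (hq : ∀ ε ∈ Icc 0 ε₀, MemLp (q ε) 2 (SturmLiouville.leb a b))
    (hρ : (SturmLiouville.resolventSet
      (SturmLiouville.operator a b (q 0) (α 0) (β 0))).Nonempty)
    (h1 : (fun ε => (eLpNorm (q ε) 2 (SturmLiouville.leb a b)).toReal)
      =O[𝓝[>] (0 : ℝ)] (fun _ => (1 : ℝ)))
    (h2 : TendstoUniformlyOn (fun ε t => ∫ x in a..t, (q ε x - q 0 x)) (fun _ => 0)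
      (𝓝[>] (0 : ℝ)) (Icc a b))
    (h3 : TendstoUniformlyOn (fun ε t => ∫ x in a..t, (q ε x ^ 2 - q 0 x ^ 2)) (fun _ => 0)
      (𝓝[>] (0 : ℝ)) (Icc a b))
    (h4 : Tendsto α (𝓝[>] (0 : ℝ)) (𝓝 (α 0)) ∧ Tendsto β (𝓝[>] (0 : ℝ)) (𝓝 (β 0))) :
    SturmLiouville.NormResolventConvergence
      (fun ε => SturmLiouville.operator a b (q ε) (α ε) (β ε)) ∧
    ∀ μ ∈ SturmLiouville.resolventSet (SturmLiouville.operator a b (q 0) (α 0) (β 0)),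
      ∃ Γ : ℝ → ℝ × ℝ → ℂ,
        SturmLiouville.IsGreenFunction a b
          (SturmLiouville.operator a b (q 0) (α 0) (β 0)) μ (Γ 0) ∧
        (∀ᶠ ε in 𝓝[>] (0 : ℝ), SturmLiouville.IsGreenFunction a b
          (SturmLiouville.operator a b (q ε) (α ε) (β ε)) μ (Γ ε)) ∧
        Tendsto (fun ε => eLpNorm (Γ ε - Γ 0) ∞
            ((SturmLiouville.leb a b).prod (SturmLiouville.leb a b)))
          (𝓝[>] (0 : ℝ)) (𝓝 0) := by
  have key := fun μ hμ =>
    SturmLiouville.exists_green_convergence (μ := μ) hab hε₀ hq h1 h2 h3 h4.1 h4.2 hμ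
  refine ⟨?_, fun μ hμ => ?_⟩
  · obtain ⟨μ, hμ⟩ := hρ
    obtain ⟨φ, ψ, N, g0, gε, ht⟩ := key μ hμ
    obtain ⟨D, hD⟩ := SturmLiouville.norm_resolvent_sub_le hab.le μ
    refine ⟨μ, hμ, gε.mono fun ε h => h.1, ?_⟩
    refine squeeze_zero' (Eventually.of_forall fun ε => norm_nonneg _)
      (gε.mono fun ε h => hD _ _ _ _ _ _ _ _ h g0) ?_
    simpa using ht.mul_const D
  · obtain ⟨φ, ψ, N, g0, gε, ht⟩ := key μ hμ
    refine ⟨fun ε => SturmLiouville.greenKernel (φ ε) (ψ ε) (N ε), g0, gε, ?_⟩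
    have ht' := ENNReal.tendsto_ofReal ht
    rw [ENNReal.ofReal_zero] at ht'
    -- The upper bound holds for every `ε`, since the comparison of kernels is pointwise and needs
    -- no Green function property.
    refine tendsto_of_tendsto_of_tendsto_of_le_of_le tendsto_const_nhds ht' (fun _ => zero_le)
      fun ε => ?_
    rw [eLpNorm_exponent_top]
    exact eLpNormEssSup_le_of_ae_bound
      (Eventually.of_forall (SturmLiouville.norm_greenKernel_sub_le _ _ _ _ _ _))
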